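/- Let $d\in\mathbb N$, let $\mathbf n=(n_1,\dots,n_d)$ with integers $n_i\ge 2$, and let $\mu_i,\nu_i$ ($i=1,\dots,d$) be Borel probability measures on $\mathbb R$ with $$\int_{\mathbb R}|x|^{n_i-1}\,d\mu_i(x)<\infty,\qquad \int_{\mathbb R}|x|^{n_i-1}\,d\nu_i(x)<\infty .$$ Definitions. For pairwise distinct reals $x_0,\dots,x_n$ the divided differences of $g\colon\mathbb R\to\mathbb R$ are $[x_0;g]=g(x_0)$ and $[x_0,\dots,x_{n};g]=\dfrac{[x_1,\dots,x_n;g]-[x_0,\dots,x_{n-1};g]}{x_n-x_0}$. The multiple divided difference of order $\mathbf n$ of $f\colon\mathbb R^d\to\mathbb R$ at nodes $\mathbf x_i=(x_{i0},\dots,x_{in_i})$, $i=1,\dots,d$, is obtained by applying the divided differences at $\mathbf x_1,\dots,\mathbf x_d$ successively to the first, ..., $d$-th argument of $f$. The function $f$ is box-$\mathbf n$-convex if all these multiple divided differences, for nodes that are pairwise distinct in each coordinate, are nonnegative. For finite signed Borel measures $\gamma_1,\gamma_2$ on $\mathbb R^d$ write $\gamma_1\prec_{box\text{-}\mathbf n\text{-}cx}\gamma_2$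 if $\int f\,d\gamma_1\le\int f\,d\gamma_2$ for every continuous box-$\mathbf n$-convex $f\colon\mathbb R^d\to\mathbb R$ that is integrable with respect to $|\gamma_1|$ and $|\gamma_2|$. For a finite signed measure $\tau$ on $\mathbb R$, $\tau^{*k}$ is its $k$-th convolution power; for a function $g$ on $\mathbb R$ and $k\ge1$, $g^{*k}$ is its $k$-th convolution power, i.e. $g^{*1}=g$ and $g^{*(k+1)}(x)=\int_{\mathbb R} g^{*k}(t)\,g(x-t)\,dt$. For a probability measure $\mu$ on $\mathbb R$ let $\overline F_\mu(x)=\mu([x,\infty))$. Then the following conditions are equivalent: a) (the Raşa inequality for continuous box-$\mathbf n$-convex functions) $$0\prec_{box\text{-}\mathbf n\text{-}cx}(\nu_1-\mu_1)^{*n_1}\otimes\dots\otimes(\nu_d-\mu_d)^{*n_d};$$ b) for all $A_1,\dots,A_d\in\mathbb R$, $$\prod_{i=1}^d\bigl(\overline F_{\nu_i}-\overline F_{\mu_i}\bigr)^{*n_i}(A_i)\ge0 .$$ -/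

import Mathlib

open MeasureTheory
open scoped Convolution

noncomputable section

/-! ### Divided differences and box-convex functions -/

/-- The divided difference `[x₀, x₁, …, xₙ; f]` of order `n`, by the usual recursion
`[x₀, …, xₙ₊₁; f] = ([x₁, …, xₙ₊₁; f] - [x₀, …, xₙ; f]) / (xₙ₊₁ - x₀)`. -/
def dividedDiff : (n : ℕ) → (Fin (n + 1) → ℝ) → (ℝ → ℝ) → ℝ
  | 0, x, f => f (x 0)
  | n + 1, x, f =>
      (dividedDiff n (fun j => x j.succ) f - dividedDiff n (fun j => x j.castSucc) f) /
        (x (Fin.last (n + 1)) - x 0)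

/-- The multiple divided difference of order `(n₁, …, n_d)` of a function of `d` real variables:
divided differences are applied to the successive arguments of `f`, the last argument being
treated last. For `d = 0` the function is a constant and the difference is its value. -/
def multiDividedDiff : {d : ℕ} → (n : Fin d → ℕ) → ((i : Fin d) → Fin (n i + 1) → ℝ) →
    ((Fin d → ℝ) → ℝ) → ℝ
  | 0, _, _, f => f Fin.elim0
  | d + 1, n, x, f =>
      dividedDiff (n (Fin.last d)) (x (Fin.last d)) fun t =>
        multiDividedDiff (fun i : Fin d => n i.castSucc) (fun i : Fin d => x i.castSucc)
          fun y => f (Fin.snoc y t)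

/-- `f : ℝᵈ → ℝ` is box-`n`-convex if all its multiple divided differences of order `n`, over
pairwise distinct nodes in every coordinate, are nonnegative. No regularity is required. -/
def IsBoxConvex {d : ℕ} (n : Fin d → ℕ) (f : (Fin d → ℝ) → ℝ) : Prop :=
  ∀ x : (i : Fin d) → Fin (n i + 1) → ℝ, (∀ i, Function.Injective (x i)) →
    0 ≤ multiDividedDiff n x f

/-! ### The box-convex order on signed measures -/

/-- The box-`n`-convex order `γ₁ ≺ γ₂` on signed measures on `ℝᵈ`: `∫ f dγ₁ ≤ ∫ f dγ₂` for all
continuous box-`n`-convex functions `f` for which both integrals exist, that is, which are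
integrable with respect to the variations `|γ₁|` and `|γ₂|`. -/
def BoxConvexLE {d : ℕ} (n : Fin d → ℕ) (γ₁ γ₂ : SignedMeasure (Fin d → ℝ)) : Prop :=
  ∀ f : (Fin d → ℝ) → ℝ, Continuous f → IsBoxConvex n f →
    γ₁.Integrable f → γ₂.Integrable f → ∫ᵛ x, f x ∂•γ₁ ≤ ∫ᵛ x, f x ∂•γ₂

/-! ### Products and convolutions of signed measures -/

/-- A (real-valued) signed measure has finite variation. In particular, the product of two
signed measures exists. -/
instance isFiniteMeasure_variation_signedMeasure {X : Type*} [MeasurableSpace X]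
    (γ : SignedMeasure X) : IsFiniteMeasure γ.variation := by
  rw [← SignedMeasure.totalVariation_eq_variation, SignedMeasure.totalVariation]
  infer_instance

/-- The product `γ₁ ⊗ γ₂` of two signed measures. -/
def signedProd {X Y : Type*} [MeasurableSpace X] [MeasurableSpace Y]
    (γ₁ : SignedMeasure X) (γ₂ : SignedMeasure Y) : SignedMeasure (X × Y) :=
  VectorMeasure.prod γ₁ γ₂ (ContinuousLinearMap.mul ℝ ℝ)

theorem signedProd_apply {X Y : Type*} [MeasurableSpace X] [MeasurableSpace Y]
    (γ₁ : SignedMeasure X) (γ₂ : SignedMeasure Y) (s : Set X) (t : Set Y) :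
    signedProd γ₁ γ₂ (s ×ˢ t) = γ₁ s * γ₂ t := by
  simp [signedProd]

/-- The product `γ₁ ⊗ … ⊗ γ_d` of signed measures on `ℝ`, as a signed measure on `ℝᵈ`. -/
def signedPi : {d : ℕ} → (Fin d → SignedMeasure ℝ) → SignedMeasure (Fin d → ℝ)
  | 0, _ => VectorMeasure.dirac Fin.elim0 1
  | d + 1, γ =>
      (signedProd (signedPi fun i : Fin d => γ i.castSucc) (γ (Fin.last d))).map
        fun p => (Fin.snoc p.1 p.2 : Fin (d + 1) → ℝ)

theorem measurable_finSnoc (d : ℕ) :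
    Measurable fun p : (Fin d → ℝ) × ℝ => (Fin.snoc p.1 p.2 : Fin (d + 1) → ℝ) := by
  refine measurable_pi_iff.2 fun i => ?_
  induction i using Fin.lastCases with
  | last => simpa using measurable_snd
  | cast i => simpa [Function.comp_def] using (measurable_pi_apply i).comp measurable_fst

/-- The characteristic property of the product measure. -/
theorem signedPi_apply {d : ℕ} (γ : Fin d → SignedMeasure ℝ) (s : Fin d → Set ℝ)
    (hs : ∀ i, MeasurableSet (s i)) :
    signedPi γ (Set.univ.pi s) = ∏ i, γ i (s i) := by
  induction d with
  | zero =>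
    rw [signedPi, VectorMeasure.dirac_apply_of_mem (MeasurableSet.univ_pi hs) (by simp)]
    simp
  | succ d ih =>
    rw [signedPi, VectorMeasure.map_apply _ (measurable_finSnoc d) (MeasurableSet.univ_pi hs)]
    have h : (fun p : (Fin d → ℝ) × ℝ => (Fin.snoc p.1 p.2 : Fin (d + 1) → ℝ)) ⁻¹'
        Set.univ.pi s = (Set.univ.pi fun i : Fin d => s i.castSucc) ×ˢ s (Fin.last d) := by
      ext p
      simp [Set.mem_pi, Fin.forall_fin_succ']
    rw [h, signedProd_apply, ih _ _ fun i => hs _, Fin.prod_univ_castSucc]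

/-- The convolution `γ₁ * γ₂` of two signed measures on `ℝ`: the image of the product under
addition. -/
def signedConv (γ₁ γ₂ : SignedMeasure ℝ) : SignedMeasure ℝ :=
  (signedProd γ₁ γ₂).map fun p => p.1 + p.2

/-- The convolution power `γ^{*k}` of a signed measure on `ℝ`, with `γ^{*0} = δ₀`. -/
def signedConvPow (γ : SignedMeasure ℝ) : ℕ → SignedMeasure ℝ
  | 0 => VectorMeasure.dirac 0 1
  | k + 1 => signedConv (signedConvPow γ k) γ

/-! ### Tails and convolution powers of functions -/

/-- The tail function `x ↦ μ([x, ∞))` of a measure on `ℝ`. -/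
def tailFun (μ : Measure ℝ) (x : ℝ) : ℝ := μ.real (Set.Ici x)

/-- The `k`-fold convolution power `g^{*k}` of a function, `k ≥ 1`: `g^{*1} = g` and
`g^{*(k+1)}(x) = ∫ g^{*k}(t) g(x - t) dt`. There is no zeroth power; its value here is `0`. -/
def funConvPow (g : ℝ → ℝ) : ℕ → ℝ → ℝ
  | 0 => 0
  | 1 => g
  | k + 2 => funConvPow g (k + 1) ⋆[ContinuousLinearMap.mul ℝ ℝ, volume] g

end

open Filter Topology

noncomputable section

/-! Put `σ i = ν i - μ i` and let `τ i` be its `n i`-th convolution power. Both conditions concern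
the integrals of truncated powers against the `τ i`: by induction on the power, the integral of
`truncPow (n i - 1) A` is `(n i - 1)!` times the convolution power of the difference of tails at `A`
(`integral_truncPow_signedConvPow`). Products of truncated powers are continuous and box-convex,
since a divided difference of order `k + 1` of a truncated `k`-th power is a B-spline value, hence
nonnegative (`finDD_truncPow_nonneg`). Testing with them gives b) from a).

For the converse, every `σ i` has total mass zero, so `τ i` annihilates polynomials of degree less
than `n i` (`vanishingMoments_signedConvPow`). Hence the integral of `f` does not change when `f` is
replaced by its successive Lagrange interpolation errors `T`, with `n i` nodes in coordinate `i`
(`exists_nodes_listErr`). For smooth `f`, Peano's formula would write `T x` as the integral over `A`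
of the mixed derivative of `f` at `A` times the errors of the truncated powers with knots `A i`;
box-convexity makes the derivative nonnegative, and Fubini with b) finishes.

A merely continuous `f` is mollified by B-splines of step `h`. The mixed derivative then becomes an
equidistant divided difference, and the formula is exact for each `h`
(`integral_gridDiff_mul_prod`). The mollifications need not be integrable against the product of the
`|τ i|`, so the integral over `A` is cut to a cube. Three facts allow `h → 0` and then the cube to
grow: for fixed `x` the kernel has a sign not depending on `A`, so truncation cannot increase the
modulus (`abs_setIntegral_dualKernel_le`); the mass of the divided differences on a cube stays
bounded (`bddAbove_setIntegral_gridDiff`); and `T` itself is integrable. The limit is carried out in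
`integral_boxConvex_nonneg`. -/

/-! ### Divided differences over finite sets of nodes -/

/-- The truncated power `x ↦ (x - A)₊ᵏ`; for `k = 0` it is the indicator of `[A, ∞)`. -/
def truncPow (k : ℕ) (A x : ℝ) : ℝ := if A ≤ x then (x - A) ^ k else 0

/-- The divided difference over a finite set of nodes, in symmetric form. -/
def finDD (s : Finset ℝ) (g : ℝ → ℝ) : ℝ := ∑ x ∈ s, g x / ∏ y ∈ s.erase x, (x - y)

theorem finDD_congr {s : Finset ℝ} {g g' : ℝ → ℝ} (h : ∀ x ∈ s, g x = g' x) :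
    finDD s g = finDD s g' :=
  Finset.sum_congr rfl fun x hx => by rw [h x hx]

theorem finDD_add (s : Finset ℝ) (g g' : ℝ → ℝ) :
    finDD s (fun x => g x + g' x) = finDD s g + finDD s g' := by
  simp [finDD, add_div, Finset.sum_add_distrib]

theorem finDD_const_mul (s : Finset ℝ) (c : ℝ) (g : ℝ → ℝ) :
    finDD s (fun x => c * g x) = c * finDD s g := by
  simp [finDD, mul_div_assoc, Finset.mul_sum]

/-- The factor kills the term of `a` and cancels one denominator in every other term. The usual
recursion and the B-spline recursion both follow from this. -/
theorem finDD_sub_mul {s : Finset ℝ} {a : ℝ} (ha : a ∈ s) (g : ℝ → ℝ) :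
    finDD s (fun x => (x - a) * g x) = finDD (s.erase a) g := by
  rw [finDD, finDD, ← Finset.add_sum_erase s _ ha]
  simp only [sub_self, zero_mul, zero_div, zero_add]
  refine Finset.sum_congr rfl fun x hx => ?_
  have hxa : x ≠ a := Finset.ne_of_mem_erase hx
  have hm : a ∈ s.erase x := Finset.mem_erase.2 ⟨hxa.symm, ha⟩
  rw [← Finset.mul_prod_erase _ _ hm, Finset.erase_right_comm,
    mul_div_mul_left _ _ (sub_ne_zero.2 hxa)]

theorem sub_mul_finDD {s : Finset ℝ} {a b : ℝ} (ha : a ∈ s) (hb : b ∈ s) (g : ℝ → ℝ) :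
    (b - a) * finDD s g = finDD (s.erase a) g - finDD (s.erase b) g := by
  rw [← finDD_sub_mul ha, ← finDD_sub_mul hb, ← finDD_const_mul, eq_sub_iff_add_eq, ← finDD_add]
  exact finDD_congr fun x _ => by ring

/-- By Lagrange interpolation, the symmetric sum is the coefficient of `P` in degree `s.card - 1`.
-/
theorem finDD_eval_eq_zero {s : Finset ℝ} {P : Polynomial ℝ} (h : P.natDegree + 1 < s.card) :
    finDD s (fun x => P.eval x) = 0 := by
  have h1 := Lagrange.coeff_eq_sum (s := s) (v := id) Function.injective_id.injOn (P := P)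
    (lt_of_le_of_lt Polynomial.degree_le_natDegree (by exact_mod_cast (by omega : P.natDegree < s.card)))
  rw [Polynomial.coeff_eq_zero_of_natDegree_lt (by omega)] at h1
  exact h1.symm

theorem finDD_pow_eq_one {s : Finset ℝ} {n : ℕ} (h : s.card = n + 1) (c : ℝ) :
    finDD s (fun x => (x + c) ^ n) = 1 := by
  have hd : ((Polynomial.X + Polynomial.C c : Polynomial ℝ) ^ n).natDegree = n := by simp
  have h1 := Lagrange.coeff_eq_sum (s := s) (v := id) Function.injective_id.injOn
    (P := (Polynomial.X + Polynomial.C c) ^ n)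
    (lt_of_le_of_lt Polynomial.degree_le_natDegree (by rw [hd, h]; exact_mod_cast n.lt_succ_self))
  have hm : ((Polynomial.X + Polynomial.C c : Polynomial ℝ) ^ n).Monic :=
    (Polynomial.monic_X_add_C c).pow n
  have h2 := hm.coeff_natDegree
  rw [hd] at h2
  rw [h, Nat.add_sub_cancel, h2] at h1
  rw [h1]
  simp [finDD]

theorem truncPow_succ (k : ℕ) (A x : ℝ) : truncPow (k + 1) A x = (x - A) * truncPow k A x := by
  unfold truncPow; split_ifs <;> ring

theorem truncPow_nonneg (k : ℕ) (A x : ℝ) : 0 ≤ truncPow k A x := by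
  unfold truncPow; split_ifs with h
  · exact pow_nonneg (by linarith) _
  · exact le_rfl

theorem truncPow_of_le {k : ℕ} {A x : ℝ} (h : A ≤ x) : truncPow k A x = (x - A) ^ k := if_pos h

theorem truncPow_of_lt {k : ℕ} {A x : ℝ} (h : x < A) : truncPow k A x = 0 := if_neg h.not_ge

theorem truncPow_eq_max {k : ℕ} (hk : k ≠ 0) (A x : ℝ) : truncPow k A x = (max (x - A) 0) ^ k := by
  unfold truncPow; split_ifs with h
  · rw [max_eq_left (by linarith)]
  · rw [max_eq_right (by linarith), zero_pow hk]

theorem finDD_truncPow_eq_zero_of_le {s : Finset ℝ} {k : ℕ} {A : ℝ} (hs : k + 1 < s.card)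
    (h : ∀ x ∈ s, A ≤ x) : finDD s (truncPow k A) = 0 := by
  rw [← finDD_eval_eq_zero (s := s) (P := (Polynomial.X - Polynomial.C A) ^ k) (by simpa using hs)]
  exact finDD_congr fun x hx => by simp [truncPow_of_le (h x hx)]

theorem finDD_truncPow_eq_zero_of_lt {s : Finset ℝ} {k : ℕ} {A : ℝ} (h : ∀ x ∈ s, x < A) :
    finDD s (truncPow k A) = 0 :=
  Finset.sum_eq_zero fun x hx => by simp [truncPow_of_lt (h x hx)]

/-- The B-spline recursion: if `A` lies between the extreme nodes `a` and `b`, the value for `k + 1`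
is a combination of the values for `k` without `a` and without `b`, with nonnegative coefficients `b
- A` and `A - a`. If `A` lies outside, the truncated power is a low-degree polynomial or zero on the
nodes. -/
theorem finDD_truncPow_nonneg {k : ℕ} (A : ℝ) {s : Finset ℝ} (hs : s.card = k + 2) :
    0 ≤ finDD s (truncPow k A) := by
  induction k generalizing s with
  | zero =>
    have key : ∀ a b : ℝ, a < b → 0 ≤ finDD {a, b} (truncPow 0 A) := by
      intro a b hab
      have h1 : ({a, b} : Finset ℝ).erase a = {b} := by ext x; simp; grind
      have h2 : ({a, b} : Finset ℝ).erase b = {a} := by ext x; simp; grind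
      have h3 := sub_mul_finDD (s := {a, b}) (a := a) (b := b) (by simp) (by simp) (truncPow 0 A)
      rw [h1, h2] at h3
      refine nonneg_of_mul_nonneg_right (a := b - a) ?_ (sub_pos.2 hab)
      rw [h3]
      simp only [finDD, Finset.sum_singleton, Finset.erase_singleton, Finset.prod_empty, div_one,
        truncPow, pow_zero]
      split_ifs <;> linarith
    obtain ⟨a, b, hab, rfl⟩ := Finset.card_eq_two.1 hs
    rcases lt_or_gt_of_ne hab with h | h
    · exact key a b h
    · rw [Finset.pair_comm]; exact key b a h
  | succ k ih =>
    have hne : s.Nonempty := Finset.card_pos.1 (by omega)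
    set a := s.min' hne with ha
    set b := s.max' hne with hb
    have has : a ∈ s := s.min'_mem hne
    have hbs : b ∈ s := s.max'_mem hne
    have hab : a < b := Finset.min'_lt_max'_of_card s (by omega)
    by_cases h1 : A < a
    · rw [finDD_truncPow_eq_zero_of_le (by omega) fun x hx => h1.le.trans (s.min'_le x hx)]
    by_cases h2 : b < A
    · rw [finDD_truncPow_eq_zero_of_lt fun x hx => (s.le_max' x hx).trans_lt h2]
    push Not at h1 h2
    have e1 : finDD s (truncPow (k + 1) A) =
        finDD (s.erase a) (truncPow k A) + (a - A) * finDD s (truncPow k A) := by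
      rw [← finDD_sub_mul has, ← finDD_const_mul, ← finDD_add]
      exact finDD_congr fun x _ => by rw [truncPow_succ]; ring
    have e2 := sub_mul_finDD has hbs (truncPow k A)
    have i1 := ih (s := s.erase a) (by rw [Finset.card_erase_of_mem has]; omega)
    have i2 := ih (s := s.erase b) (by rw [Finset.card_erase_of_mem hbs]; omega)
    refine nonneg_of_mul_nonneg_right (a := b - a) ?_ (sub_pos.2 hab)
    have : (b - a) * finDD s (truncPow (k + 1) A) =
        (b - A) * finDD (s.erase a) (truncPow k A) + (A - a) * finDD (s.erase b) (truncPow k A) := by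
      rw [e1]; linear_combination (a - A) * e2
    rw [this]
    exact add_nonneg (mul_nonneg (by linarith) i1) (mul_nonneg (by linarith) i2)

/-! ### Comparison with the recursive divided differences -/

/-- Dropping the first or the last node is erasing an element of the node set, so the defining
recursion is `sub_mul_finDD`. -/
theorem dividedDiff_eq_finDD {n : ℕ} {x : Fin (n + 1) → ℝ} (hx : Function.Injective x)
    (f : ℝ → ℝ) : dividedDiff n x f = finDD (Finset.univ.image x) f := by
  induction n with
  | zero => simp [dividedDiff, finDD]
  | succ n ih =>
    have h0 : (Finset.univ.image x).erase (x 0) = Finset.univ.image fun j : Fin (n + 1) => x j.succ := by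
      ext t
      simp only [Finset.mem_erase, Finset.mem_image, Finset.mem_univ, true_and]
      constructor
      · rintro ⟨h, j, rfl⟩
        exact ⟨j.pred fun hj => h (by rw [hj]), by simp⟩
      · rintro ⟨j, rfl⟩
        exact ⟨fun h => Fin.succ_ne_zero j (hx h), _, rfl⟩
    have h1 : (Finset.univ.image x).erase (x (Fin.last (n + 1))) =
        Finset.univ.image fun j : Fin (n + 1) => x j.castSucc := by
      ext t
      simp only [Finset.mem_erase, Finset.mem_image, Finset.mem_univ, true_and]
      constructor
      · rintro ⟨h, j, rfl⟩
        exact ⟨j.castPred fun hj => h (by rw [hj]), by simp⟩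
      · rintro ⟨j, rfl⟩
        exact ⟨fun h => (Fin.castSucc_lt_last j).ne (hx h), _, rfl⟩
    have hne : x (Fin.last (n + 1)) - x 0 ≠ 0 :=
      sub_ne_zero.2 fun h => (Fin.last_pos (n := n)).ne' (hx h)
    rw [dividedDiff, ih (x := fun j => x j.succ) (hx.comp (Fin.succ_injective _)),
      ih (x := fun j => x j.castSucc) (hx.comp (Fin.castSucc_injective _)), ← h0, ← h1,
      ← sub_mul_finDD (by simp) (by simp), mul_div_cancel_left₀ _ hne]

theorem finDD_image {ι : Type*} [Fintype ι] [DecidableEq ι] {x : ι → ℝ} (hx : Function.Injective x)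
    (f : ℝ → ℝ) :
    finDD (Finset.univ.image x) f = ∑ j, Lagrange.nodalWeight Finset.univ x j * f (x j) := by
  rw [finDD, Finset.sum_image hx.injOn]
  refine Finset.sum_congr rfl fun j _ => ?_
  have : (Finset.univ.image x).erase (x j) = (Finset.univ.erase j).image x := by
    rw [Finset.image_erase hx]
  rw [this, Finset.prod_image hx.injOn, Lagrange.nodalWeight, Finset.prod_inv_distrib]
  ring

theorem dividedDiff_eq_sum {n : ℕ} {x : Fin (n + 1) → ℝ} (hx : Function.Injective x)
    (f : ℝ → ℝ) :
    dividedDiff n x f = ∑ j, Lagrange.nodalWeight Finset.univ x j * f (x j) := by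
  rw [dividedDiff_eq_finDD hx, finDD_image hx]

theorem multiDividedDiff_eq_sum {d : ℕ} (n : Fin d → ℕ) (x : (i : Fin d) → Fin (n i + 1) → ℝ)
    (hx : ∀ i, Function.Injective (x i)) (f : (Fin d → ℝ) → ℝ) :
    multiDividedDiff n x f = ∑ j : (i : Fin d) → Fin (n i + 1),
      (∏ i, Lagrange.nodalWeight Finset.univ (x i) (j i)) * f fun i => x i (j i) := by
  induction d with
  | zero => simp [multiDividedDiff]; exact congrArg f (Subsingleton.elim _ _)
  | succ d ih =>
    rw [multiDividedDiff, dividedDiff_eq_sum (hx _)]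
    simp_rw [ih (fun i => n i.castSucc) (fun i => x i.castSucc) (fun i => hx _), Finset.mul_sum]
    rw [← (Fin.snocEquiv fun i : Fin (d + 1) => Fin (n i + 1)).sum_comp, Fintype.sum_prod_type]
    refine Finset.sum_congr rfl fun a _ => Finset.sum_congr rfl fun b _ => ?_
    rw [Fin.prod_univ_castSucc]
    simp only [Fin.snocEquiv_apply, Fin.snoc_castSucc, Fin.snoc_last]
    have : (Fin.snoc (fun i : Fin d => x i.castSucc (b i)) (x (Fin.last d) a) : Fin (d + 1) → ℝ) =
        fun i => x i ((Fin.snoc b a : (i : Fin (d + 1)) → Fin (n i + 1)) i) := by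
      funext i
      induction i using Fin.lastCases <;> simp
    rw [this]; ring

/-! ### The error of Lagrange interpolation -/

/-- The error at `t` of the Lagrange interpolation of `φ` with nodes `X`. -/
def interpErr (X : Finset ℝ) (φ : ℝ → ℝ) (t : ℝ) : ℝ :=
  φ t - ∑ a ∈ X, (Lagrange.basis X id a).eval t * φ a

theorem interpErr_eq_zero_of_mem {X : Finset ℝ} {t : ℝ} (ht : t ∈ X) (φ : ℝ → ℝ) :
    interpErr X φ t = 0 := by
  have h := Lagrange.eval_interpolate_at_node (s := X) (v := id) φ Function.injective_id.injOn ht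
  simp only [Lagrange.interpolate_apply, Polynomial.eval_finsetSum, Polynomial.eval_mul,
    Polynomial.eval_C, id] at h
  rw [interpErr, ← h, sub_eq_zero]
  exact Finset.sum_congr rfl fun a _ => mul_comm _ _

/-- Newton's error formula. For truncated powers the second factor is nonnegative, so the sign of
the error is that of the nodal product, whatever the knot. -/
theorem interpErr_eq_finDD {X : Finset ℝ} {t : ℝ} (ht : t ∉ X) (φ : ℝ → ℝ) :
    interpErr X φ t = (∏ a ∈ X, (t - a)) * finDD (insert t X) φ := by
  have hne : ∀ a ∈ X, t - a ≠ 0 := fun a ha => sub_ne_zero.2 fun h => ht (h ▸ ha)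
  rw [interpErr, finDD, Finset.sum_insert ht, Finset.erase_insert ht, mul_add,
    mul_div_cancel₀ _ (Finset.prod_ne_zero_iff.2 hne), sub_eq_add_neg, ← Finset.sum_neg_distrib,
    Finset.mul_sum]
  congr 1
  refine Finset.sum_congr rfl fun a ha => ?_
  have hta : t ≠ a := fun h => ht (h ▸ ha)
  rw [Lagrange.eval_basis_not_at_node ha hta, Lagrange.eval_nodal, Lagrange.nodalWeight,
    Finset.erase_insert_of_ne hta, Finset.prod_insert fun h => ht (Finset.mem_of_mem_erase h),
    Finset.prod_inv_distrib]
  have h1 := hne a ha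
  have h2 : a - t ≠ 0 := sub_ne_zero.2 hta.symm
  have h3 : ∏ y ∈ X.erase a, (a - y) ≠ 0 := Finset.prod_ne_zero_iff.2 fun y hy =>
    sub_ne_zero.2 (Finset.ne_of_mem_erase hy).symm
  simp only [id]
  field_simp
  ring

theorem prod_mul_interpErr_truncPow_nonneg {X : Finset ℝ} {k : ℕ} (hX : X.card = k + 1) (A t : ℝ) :
    0 ≤ (∏ a ∈ X, (t - a)) * interpErr X (truncPow k A) t := by
  by_cases ht : t ∈ X
  · rw [interpErr_eq_zero_of_mem ht, mul_zero]
  · rw [interpErr_eq_finDD ht, ← mul_assoc]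
    exact mul_nonneg (mul_self_nonneg _)
      (finDD_truncPow_nonneg A (by rw [Finset.card_insert_of_notMem ht, hX]))

/-- At a given point, the kernels `interpErr X (truncPow k A)` have a sign independent of `A`. -/
theorem abs_interpErr_truncPow {X : Finset ℝ} {k : ℕ} (hX : X.card = k + 1) (A t : ℝ) :
    |interpErr X (truncPow k A) t| =
      SignType.sign (∏ a ∈ X, (t - a)) * interpErr X (truncPow k A) t := by
  have h := prod_mul_interpErr_truncPow_nonneg hX A t
  rcases lt_trichotomy (∏ a ∈ X, (t - a)) 0 with h0 | h0 | h0
  · rw [sign_neg h0, abs_of_nonpos (nonpos_of_mul_nonneg_right h h0)]; simp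
  · obtain ⟨a, ha, h1⟩ := Finset.prod_eq_zero_iff.1 h0
    rw [interpErr_eq_zero_of_mem (by rwa [sub_eq_zero.1 h1])]; simp
  · rw [sign_pos h0, abs_of_nonneg (nonneg_of_mul_nonneg_right h h0)]; simp

theorem interpErr_truncPow_eq_zero_of_lt {X : Finset ℝ} {k : ℕ} {A t : ℝ} (ht : t < A)
    (hX : ∀ a ∈ X, a < A) : interpErr X (truncPow k A) t = 0 := by
  rw [interpErr, truncPow_of_lt ht, Finset.sum_eq_zero, sub_zero]
  exact fun a ha => by rw [truncPow_of_lt (hX a ha), mul_zero]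

/-- Where the truncation is inactive, the function is a polynomial of degree `k`, reproduced by `k +
1` nodes. -/
theorem interpErr_truncPow_eq_zero_of_le {X : Finset ℝ} {k : ℕ} (hc : X.card = k + 1) {A t : ℝ}
    (ht : A ≤ t) (hX : ∀ a ∈ X, A ≤ a) : interpErr X (truncPow k A) t = 0 := by
  by_cases htX : t ∈ X
  · exact interpErr_eq_zero_of_mem htX _
  · rw [interpErr_eq_finDD htX, finDD_truncPow_eq_zero_of_le, mul_zero]
    · rw [Finset.card_insert_of_notMem htX]; omega
    · simpa using ⟨ht, hX⟩

theorem interpErr_truncPow_of_lt {X : Finset ℝ} {k : ℕ} {A t : ℝ} (ht : A ≤ t)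
    (hX : ∀ a ∈ X, a < A) : interpErr X (truncPow k A) t = (t - A) ^ k := by
  rw [interpErr, truncPow_of_le ht, Finset.sum_eq_zero, sub_zero]
  exact fun a ha => by rw [truncPow_of_lt (hX a ha), mul_zero]

theorem continuous_truncPow {k : ℕ} (hk : k ≠ 0) :
    Continuous fun p : ℝ × ℝ => truncPow k p.1 p.2 := by
  simp_rw [truncPow_eq_max hk]; fun_prop

theorem continuous_interpErr_truncPow (X : Finset ℝ) {k : ℕ} (hk : k ≠ 0) :
    Continuous fun p : ℝ × ℝ => interpErr X (truncPow k p.1) p.2 := by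
  unfold interpErr
  refine ((continuous_truncPow hk)).sub (continuous_finsetSum _ fun a _ => Continuous.mul ?_ ?_)
  · exact (Polynomial.continuous _).comp continuous_snd
  · exact (continuous_truncPow hk).comp (continuous_fst.prodMk continuous_const)

theorem interpErr_sum {ι : Type*} (s : Finset ι) (X : Finset ℝ) (c : ι → ℝ) (φ : ι → ℝ → ℝ) (t : ℝ) :
    interpErr X (fun x => ∑ j ∈ s, c j * φ j x) t = ∑ j ∈ s, c j * interpErr X (φ j) t := by
  simp only [interpErr, mul_sub, Finset.sum_sub_distrib, Finset.mul_sum]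
  rw [Finset.sum_comm]
  simp only [mul_left_comm]

/-! ### B-spline kernels and mollification -/

/-- The coefficients of the divided difference with the `n + 1` equidistant nodes `A + j * h`. -/
def gridWeight (n : ℕ) (h : ℝ) (j : Fin (n + 1)) : ℝ :=
  Lagrange.nodalWeight Finset.univ (fun j : Fin (n + 1) => (j : ℝ) * h) j

theorem grid_injective (n : ℕ) {h : ℝ} (hh : 0 < h) (A : ℝ) :
    Function.Injective fun j : Fin (n + 1) => A + (j : ℝ) * h := fun i j hij => by
  have := mul_right_cancel₀ hh.ne' (add_left_cancel hij)
  exact Fin.ext (by exact_mod_cast this)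

theorem nodalWeight_grid (n : ℕ) (h A : ℝ) (j : Fin (n + 1)) :
    Lagrange.nodalWeight Finset.univ (fun j : Fin (n + 1) => A + (j : ℝ) * h) j =
      gridWeight n h j := by
  simp [Lagrange.nodalWeight, gridWeight]

/-- The B-spline with nodes `0, h, …, n * h`. -/
def bspline (n : ℕ) (h u : ℝ) : ℝ := ∑ j, gridWeight n h j * truncPow (n - 1) u ((j : ℝ) * h)

/-- The nodes of `bspline n h`. -/
def gridNodes (n : ℕ) (h : ℝ) : Finset ℝ :=
  Finset.univ.image fun j : Fin (n + 1) => 0 + (j : ℝ) * h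

theorem card_gridNodes (n : ℕ) {h : ℝ} (hh : 0 < h) : (gridNodes n h).card = n + 1 := by
  rw [gridNodes, Finset.card_image_of_injective _ (grid_injective n hh 0), Finset.card_univ,
    Fintype.card_fin]

theorem sum_gridWeight_mul (n : ℕ) {h : ℝ} (hh : 0 < h) (g : ℝ → ℝ) :
    ∑ j, gridWeight n h j * g ((j : ℝ) * h) = finDD (gridNodes n h) g := by
  rw [gridNodes, finDD_image (grid_injective n hh 0)]
  refine Finset.sum_congr rfl fun j _ => ?_
  rw [nodalWeight_grid, zero_add]

theorem bspline_eq_finDD (n : ℕ) {h : ℝ} (hh : 0 < h) (u : ℝ) :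
    bspline n h u = finDD (gridNodes n h) (truncPow (n - 1) u) :=
  sum_gridWeight_mul n hh _

theorem mem_gridNodes {n : ℕ} {h : ℝ} (hh : 0 < h) {x : ℝ} (hx : x ∈ gridNodes n h) :
    0 ≤ x ∧ x ≤ n * h := by
  simp only [gridNodes, Finset.mem_image, Finset.mem_univ, true_and, zero_add] at hx
  obtain ⟨j, rfl⟩ := hx
  exact ⟨by positivity, mul_le_mul_of_nonneg_right (by exact_mod_cast Nat.lt_succ_iff.1 j.2) hh.le⟩

theorem bspline_nonneg {n : ℕ} (hn : n ≠ 0) {h : ℝ} (hh : 0 < h) (u : ℝ) : 0 ≤ bspline n h u := by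
  rw [bspline_eq_finDD n hh]
  exact finDD_truncPow_nonneg u (by rw [card_gridNodes n hh]; omega)

theorem bspline_eq_zero_of_nonpos {n : ℕ} (hn : n ≠ 0) {h : ℝ} (hh : 0 < h) {u : ℝ} (hu : u ≤ 0) :
    bspline n h u = 0 := by
  rw [bspline_eq_finDD n hh]
  exact finDD_truncPow_eq_zero_of_le (by rw [card_gridNodes n hh]; omega)
    fun x hx => hu.trans (mem_gridNodes hh hx).1

theorem bspline_eq_zero_of_lt {n : ℕ} {h : ℝ} (hh : 0 < h) {u : ℝ} (hu : n * h < u) :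
    bspline n h u = 0 := by
  rw [bspline_eq_finDD n hh]
  exact finDD_truncPow_eq_zero_of_lt fun x hx => (mem_gridNodes hh hx).2.trans_lt hu

theorem continuous_bspline {n : ℕ} (hn : 2 ≤ n) (h : ℝ) : Continuous (bspline n h) :=
  continuous_finsetSum _ fun _ _ => continuous_const.mul
    ((continuous_truncPow (by omega)).comp (continuous_id.prodMk continuous_const))

theorem integral_truncPow {k : ℕ} (hk : k ≠ 0) {p q : ℝ} (hp : 0 ≤ p) (hq : p ≤ q) :
    ∫ u in (0 : ℝ)..q, truncPow k u p = p ^ (k + 1) / (k + 1 : ℕ) := by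
  have hc : Continuous fun u => truncPow k u p :=
    (continuous_truncPow hk).comp (continuous_id.prodMk continuous_const)
  rw [← intervalIntegral.integral_add_adjacent_intervals (hc.intervalIntegrable 0 p)
    (hc.intervalIntegrable p q)]
  have h1 : ∫ u in (0 : ℝ)..p, truncPow k u p = ∫ u in (0 : ℝ)..p, (p - u) ^ k := by
    refine intervalIntegral.integral_congr fun u hu => ?_
    rw [Set.uIcc_of_le hp] at hu
    exact truncPow_of_le hu.2
  have h2 : ∫ u in p..q, truncPow k u p = ∫ u in p..q, (0 : ℝ) := by
    refine intervalIntegral.integral_congr fun u hu => ?_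
    rw [Set.uIcc_of_le hq] at hu
    rcases hu.1.eq_or_lt with h | h
    · simp [← h, truncPow_of_le le_rfl, hk]
    · exact truncPow_of_lt h
  rw [h1, h2, intervalIntegral.integral_comp_sub_left (fun u => u ^ k)]
  simp

/-- Integrating over the knot turns the truncated power at a node `p` into `p ^ n / n`, and the
divided difference of order `n` of the `n`-th power is `1`. The value does not depend on `h`. -/
theorem integral_bspline {n : ℕ} (hn : 2 ≤ n) {h : ℝ} (hh : 0 < h) :
    ∫ u, bspline n h u = (n : ℝ)⁻¹ := by
  have hq : (0 : ℝ) ≤ n * h := by positivity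
  have h1 : ∫ u, bspline n h u = ∫ u in (0 : ℝ)..n * h, bspline n h u := by
    rw [intervalIntegral.integral_of_le hq]
    refine (setIntegral_eq_integral_of_forall_compl_eq_zero fun u hu => ?_).symm
    simp only [Set.mem_Ioc, not_and_or, not_lt, not_le] at hu
    exact hu.elim (bspline_eq_zero_of_nonpos (by omega) hh) (bspline_eq_zero_of_lt hh)
  rw [h1]
  unfold bspline
  have hc : ∀ j : Fin (n + 1), Continuous fun u =>
      gridWeight n h j * truncPow (n - 1) u ((j : ℝ) * h) := fun j => continuous_const.mul
    ((continuous_truncPow (k := n - 1) (by omega)).comp (continuous_id.prodMk continuous_const))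
  rw [intervalIntegral.integral_finsetSum fun j _ => (hc j).intervalIntegrable _ _]
  have h2 : ∀ j : Fin (n + 1), ∫ u in (0 : ℝ)..n * h,
      gridWeight n h j * truncPow (n - 1) u ((j : ℝ) * h) =
        (n : ℝ)⁻¹ * (gridWeight n h j * (fun x : ℝ => (x + 0) ^ n) ((j : ℝ) * h)) := by
    intro j
    rw [intervalIntegral.integral_const_mul, integral_truncPow (by omega) (by positivity)
      (mul_le_mul_of_nonneg_right (by exact_mod_cast Nat.lt_succ_iff.1 j.2) hh.le),
      Nat.sub_add_cancel (by omega)]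
    simp only [add_zero]
    ring
  simp_rw [h2]
  rw [← Finset.mul_sum, sum_gridWeight_mul n hh fun x => (x + 0) ^ n, finDD_pow_eq_one (card_gridNodes n hh), mul_one]

theorem integrable_mul_prod {d : ℕ} {g : (Fin d → ℝ) → ℝ} (hg : Continuous g)
    {φ : Fin d → ℝ → ℝ} (hφ : ∀ i, Continuous (φ i)) {r : ℝ} (h0 : ∀ i t, r < |t| → φ i t = 0) :
    Integrable fun v : Fin d → ℝ => g v * ∏ i, φ i (v i) := by
  refine Continuous.integrable_of_hasCompactSupport
    (hg.mul (continuous_finsetProd _ fun i _ => (hφ i).comp (continuous_apply i))) ?_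
  refine HasCompactSupport.intro (isCompact_univ_pi fun _ : Fin d => isCompact_Icc (a := -r) (b := r))
    fun v hv => ?_
  simp only [Set.mem_pi, Set.mem_univ, true_implies, not_forall] at hv
  obtain ⟨i, hi⟩ := hv
  rw [Set.mem_Icc, ← abs_le, not_le] at hi
  rw [Finset.prod_eq_zero (Finset.mem_univ i) (h0 i _ hi), mul_zero]

/-- A mollification of `f` by a product of B-splines. -/
def mollify {d : ℕ} (n : Fin d → ℕ) (h : ℝ) (f : (Fin d → ℝ) → ℝ) (p : Fin d → ℝ) : ℝ :=
  ∫ v, f v * ∏ i, bspline (n i) h (v i - p i)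

theorem integral_prod_bspline {d : ℕ} {n : Fin d → ℕ} (hn : ∀ i, 2 ≤ n i) {h : ℝ} (hh : 0 < h)
    (p : Fin d → ℝ) : ∫ v : Fin d → ℝ, ∏ i, bspline (n i) h (v i - p i) = ∏ i, (n i : ℝ)⁻¹ := by
  rw [integral_fintype_prod_volume_eq_prod fun i t => bspline (n i) h (t - p i)]
  refine Finset.prod_congr rfl fun i _ => ?_
  rw [integral_sub_right_eq_self (bspline (n i) h), integral_bspline (hn i) hh]

theorem integrable_mul_prod_bspline {d : ℕ} {n : Fin d → ℕ} (hn : ∀ i, 2 ≤ n i) {h : ℝ} (hh : 0 < h)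
    {f : (Fin d → ℝ) → ℝ} (hf : Continuous f) (p : Fin d → ℝ) :
    Integrable fun v : Fin d → ℝ => f v * ∏ i, bspline (n i) h (v i - p i) := by
  have hr : ∃ r : ℝ, ∀ i, |p i| + n i * h ≤ r := by
    obtain ⟨r, hr⟩ := (Set.finite_range fun i => |p i| + n i * h).bddAbove
    exact ⟨r, fun i => hr ⟨i, rfl⟩⟩
  obtain ⟨r, hr⟩ := hr
  refine integrable_mul_prod hf (φ := fun i t => bspline (n i) h (t - p i))
    (fun i => (continuous_bspline (hn i) h).comp (continuous_id.sub continuous_const)) (r := r) ?_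
  intro i t ht
  have h1 := hr i
  have h2 := hn i
  have h3 : (0 : ℝ) ≤ n i * h := by positivity
  rcases le_or_gt (t - p i) 0 with h4 | h4
  · exact bspline_eq_zero_of_nonpos (by omega) hh h4
  · refine bspline_eq_zero_of_lt hh (not_le.1 fun h5 => ?_)
    have := abs_add_le (t - p i) (p i)
    rw [sub_add_cancel, abs_of_pos h4] at this
    linarith

/-- An approximate identity up to a constant: the kernels are nonnegative, have fixed mass, and
their supports shrink to `p` as `h → 0`. -/
theorem tendsto_mollify {d : ℕ} {n : Fin d → ℕ} (hn : ∀ i, 2 ≤ n i) {f : (Fin d → ℝ) → ℝ}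
    (hf : Continuous f) (p : Fin d → ℝ) :
    Tendsto (fun h => mollify n h f p) (𝓝[>] 0) (𝓝 ((∏ i, (n i : ℝ)⁻¹) * f p)) := by
  have hC : 0 ≤ ∏ i, (n i : ℝ)⁻¹ := Finset.prod_nonneg fun i _ => by positivity
  rw [Metric.tendsto_nhds]
  intro ε hε
  set η : ℝ := ε / (∏ i, (n i : ℝ)⁻¹ + 1) with hη
  have hη0 : 0 < η := by positivity
  obtain ⟨δ, hδ, hδf⟩ := Metric.continuous_iff.1 hf p η hη0
  have hN : ∃ N : ℝ, 0 < N ∧ ∀ i, (n i : ℝ) ≤ N := by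
    obtain ⟨r, hr⟩ := (Set.finite_range fun i => (n i : ℝ)).bddAbove
    exact ⟨max r 1, by positivity, fun i => (hr ⟨i, rfl⟩).trans (le_max_left _ _)⟩
  obtain ⟨N, hN0, hN⟩ := hN
  filter_upwards [Ioo_mem_nhdsGT (show (0 : ℝ) < δ / N by positivity)] with h hh
  have hh0 : 0 < h := hh.1
  have hNh : N * h < δ := by have := hh.2; rwa [lt_div_iff₀ hN0, mul_comm] at this
  have hnn : ∀ v : Fin d → ℝ, 0 ≤ ∏ i, bspline (n i) h (v i - p i) := fun v =>
    Finset.prod_nonneg fun i _ => bspline_nonneg (by have := hn i; omega) hh0 _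
  have hi1 := integrable_mul_prod_bspline hn hh0 hf p
  have hi2 : Integrable fun v : Fin d → ℝ => f p * ∏ i, bspline (n i) h (v i - p i) :=
    integrable_mul_prod_bspline hn hh0 continuous_const p
  have hi3 : Integrable fun v : Fin d → ℝ => η * ∏ i, bspline (n i) h (v i - p i) :=
    integrable_mul_prod_bspline hn hh0 continuous_const p
  have e : mollify n h f p - (∏ i, (n i : ℝ)⁻¹) * f p =
      ∫ v, (f v * ∏ i, bspline (n i) h (v i - p i) - f p * ∏ i, bspline (n i) h (v i - p i)) := by
    rw [integral_sub hi1 hi2, integral_const_mul, integral_prod_bspline hn hh0, mul_comm (f p)]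
    rfl
  rw [Real.dist_eq, e]
  calc ‖∫ v : Fin d → ℝ, (f v * ∏ i, bspline (n i) h (v i - p i) -
          f p * ∏ i, bspline (n i) h (v i - p i))‖
      ≤ ∫ v : Fin d → ℝ, η * ∏ i, bspline (n i) h (v i - p i) := by
        refine norm_integral_le_of_norm_le (μ := volume) hi3 (Eventually.of_forall fun v => ?_)
        rw [← sub_mul, norm_mul, Real.norm_of_nonneg (hnn v)]
        by_cases hv : dist v p < δ
        · exact mul_le_mul_of_nonneg_right (hδf v hv).le (hnn v)
        · have : ∏ i, bspline (n i) h (v i - p i) = 0 := by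
            rw [dist_pi_lt_iff hδ] at hv
            push Not at hv
            obtain ⟨i, hi⟩ := hv
            refine Finset.prod_eq_zero (Finset.mem_univ i) ?_
            rcases le_or_gt (v i - p i) 0 with h4 | h4
            · exact bspline_eq_zero_of_nonpos (by have := hn i; omega) hh0 h4
            · refine bspline_eq_zero_of_lt hh0 ?_
              rw [Real.dist_eq, abs_of_pos h4] at hi
              nlinarith [hN i]
          simp [this]
    _ = η * ∏ i, (n i : ℝ)⁻¹ := by rw [integral_const_mul, integral_prod_bspline hn hh0]
    _ < η * (∏ i, (n i : ℝ)⁻¹ + 1) := by nlinarith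
    _ = ε := by rw [hη]; field_simp

/-! ### Interpolation errors in several coordinates -/

/-- The error of Lagrange interpolation in the `i`-th coordinate. -/
def coordErr {d : ℕ} (X : Fin d → Finset ℝ) (i : Fin d) (f : (Fin d → ℝ) → ℝ) (x : Fin d → ℝ) : ℝ :=
  f x - ∑ a ∈ X i, (Lagrange.basis (X i) id a).eval (x i) * f (Function.update x i a)

/-- The successive interpolation errors in the coordinates of a list. -/
def listErr {d : ℕ} (X : Fin d → Finset ℝ) (l : List (Fin d)) (f : (Fin d → ℝ) → ℝ) :
    (Fin d → ℝ) → ℝ :=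
  l.foldr (coordErr X) f

theorem coordErr_prod {d : ℕ} (X : Fin d → Finset ℝ) (i : Fin d) (ψ : Fin d → ℝ → ℝ) (x : Fin d → ℝ) :
    coordErr X i (fun x => ∏ j, ψ j (x j)) x =
      ∏ j, (Function.update ψ i (interpErr (X i) (ψ i)) j) (x j) := by
  have h1 : ∀ a, ∏ j, ψ j (Function.update x i a j) =
      ψ i a * ∏ j ∈ Finset.univ.erase i, ψ j (x j) := fun a => by
    rw [← Finset.mul_prod_erase _ _ (Finset.mem_univ i), Function.update_self]
    congr 1
    exact Finset.prod_congr rfl fun j hj => by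
      rw [Function.update_of_ne (Finset.ne_of_mem_erase hj)]
  have h2 : ∏ j, (Function.update ψ i (interpErr (X i) (ψ i)) j) (x j) =
      interpErr (X i) (ψ i) (x i) * ∏ j ∈ Finset.univ.erase i, ψ j (x j) := by
    rw [← Finset.mul_prod_erase _ _ (Finset.mem_univ i), Function.update_self]
    congr 1
    exact Finset.prod_congr rfl fun j hj => by
      rw [Function.update_of_ne (Finset.ne_of_mem_erase hj)]
  have h3 : ∏ j, ψ j (x j) = ψ i (x i) * ∏ j ∈ Finset.univ.erase i, ψ j (x j) := by
    rw [← Finset.mul_prod_erase _ _ (Finset.mem_univ i)]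
  rw [coordErr, h2, h3, interpErr, sub_mul, Finset.sum_mul]
  simp only [h1, mul_assoc]

theorem coordErr_integral {d : ℕ} {α : Type*} [MeasurableSpace α] {μ : Measure α}
    (X : Fin d → Finset ℝ) (i : Fin d)
    {F : α → (Fin d → ℝ) → ℝ} (hF : ∀ x, Integrable (fun v => F v x) μ) (x : Fin d → ℝ) :
    Integrable (fun v => coordErr X i (F v) x) μ ∧
      coordErr X i (fun x => ∫ v, F v x ∂μ) x = ∫ v, coordErr X i (F v) x ∂μ := by
  have h1 : Integrable (fun v => ∑ a ∈ X i, (Lagrange.basis (X i) id a).eval (x i) *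
      F v (Function.update x i a)) μ :=
    integrable_finsetSum _ fun a _ => (hF _).const_mul _
  refine ⟨(hF x).sub h1, ?_⟩
  unfold coordErr
  rw [integral_sub (hF x) h1, integral_finsetSum _ fun a _ => (hF _).const_mul _]
  simp only [integral_const_mul]

/-- Interpolation in one coordinate is a finite linear combination of evaluations, so it passes
under the integral and acts on a single factor of the product. Distinctness of the list entries
ensures that each factor is treated at most once. -/
theorem listErr_integral_prod {d : ℕ} {α : Type*} [MeasurableSpace α] {μ : Measure α}
    (X : Fin d → Finset ℝ) {f : α → ℝ} {φ : Fin d → α → ℝ → ℝ}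
    (hF : ∀ x : Fin d → ℝ, Integrable (fun v => f v * ∏ i, φ i v (x i)) μ)
    {l : List (Fin d)} (hl : l.Nodup) (x : Fin d → ℝ) :
    Integrable (fun v => f v * ∏ i, (if i ∈ l then interpErr (X i) (φ i v) else φ i v) (x i)) μ ∧
    listErr X l (fun x => ∫ v, f v * ∏ i, φ i v (x i) ∂μ) x =
      ∫ v, f v * ∏ i, (if i ∈ l then interpErr (X i) (φ i v) else φ i v) (x i) ∂μ := by
  induction l generalizing x with
  | nil => simpa [listErr] using hF x
  | cons i l ih =>
    have hi := (List.nodup_cons.1 hl).1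
    have ih' := ih (List.nodup_cons.1 hl).2
    have key := coordErr_integral X i (fun x => (ih' x).1) x
    have e : ∀ v, coordErr X i (fun x => f v *
        ∏ j, (if j ∈ l then interpErr (X j) (φ j v) else φ j v) (x j)) x =
          f v * ∏ j, (if j ∈ i :: l then interpErr (X j) (φ j v) else φ j v) (x j) := by
      intro v
      have h1 : ∀ g : (Fin d → ℝ) → ℝ, coordErr X i (fun x => f v * g x) x =
          f v * coordErr X i g x := fun g => by
        simp only [coordErr, mul_sub, Finset.mul_sum]
        congr 1
        exact Finset.sum_congr rfl fun a _ => by ring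
      rw [h1, coordErr_prod X i fun j => if j ∈ l then interpErr (X j) (φ j v) else φ j v]
      congr 1
      refine Finset.prod_congr rfl fun j _ => ?_
      by_cases hj : j = i
      · subst hj; simp [hi]
      · rw [Function.update_of_ne hj]; simp [hj]
    simp only [e] at key
    refine ⟨key.1, ?_⟩
    rw [← key.2, listErr, List.foldr_cons]
    congr 1
    funext y
    exact (ih' y).2

/-! ### The duality between mollified divided differences and interpolation errors -/

/-- The divided difference of `f` over the equidistant nodes starting at `A`, with step `h`. -/
def gridDiff {d : ℕ} (n : Fin d → ℕ) (h : ℝ) (f : (Fin d → ℝ) → ℝ) (A : Fin d → ℝ) : ℝ :=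
  ∑ j : (i : Fin d) → Fin (n i + 1), (∏ i, gridWeight (n i) h (j i)) *
    f fun i => A i + (j i : ℝ) * h

theorem gridDiff_nonneg {d : ℕ} {n : Fin d → ℕ} {h : ℝ} (hh : 0 < h) {f : (Fin d → ℝ) → ℝ}
    (hf : IsBoxConvex n f) (A : Fin d → ℝ) : 0 ≤ gridDiff n h f A := by
  have h1 := hf (fun i j => A i + (j : ℝ) * h) fun i => grid_injective (n i) hh (A i)
  rw [multiDividedDiff_eq_sum n _ fun i => grid_injective (n i) hh (A i)] at h1
  simpa only [nodalWeight_grid, gridDiff] using h1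

theorem continuous_gridDiff {d : ℕ} (n : Fin d → ℕ) (h : ℝ) {f : (Fin d → ℝ) → ℝ}
    (hf : Continuous f) : Continuous (gridDiff n h f) :=
  continuous_finsetSum _ fun _ _ => continuous_const.mul (hf.comp (by fun_prop))

/-- As functions of the knot, the kernels have compact support: beyond the nodes and `x i` on the
right all truncated powers vanish, and on the left they are polynomials, reproduced exactly. -/
theorem exists_forall_interpErr_eq_zero {d : ℕ} {n : Fin d → ℕ} (hn : ∀ i, 2 ≤ n i)
    {X : Fin d → Finset ℝ} (hX : ∀ i, (X i).card = n i) (x : Fin d → ℝ) :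
    ∃ r : ℝ, ∀ i t, r < |t| → interpErr (X i) (truncPow (n i - 1) t) (x i) = 0 := by
  have h1 : ∀ i, ∃ r : ℝ, ∀ t, r < |t| → interpErr (X i) (truncPow (n i - 1) t) (x i) = 0 := by
    intro i
    obtain ⟨r, hr⟩ := ((insert (x i) (X i)).finite_toSet.image fun a => |a|).bddAbove
    have hr' : ∀ a ∈ insert (x i) (X i), |a| ≤ r := fun a ha => hr ⟨a, ha, rfl⟩
    refine ⟨r, fun t ht => ?_⟩
    rcases lt_abs.1 ht with h | h
    · exact interpErr_truncPow_eq_zero_of_lt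
        ((le_abs_self _).trans_lt ((hr' _ (Finset.mem_insert_self _ _)).trans_lt h))
        fun a ha => (le_abs_self _).trans_lt ((hr' _ (Finset.mem_insert_of_mem ha)).trans_lt h)
    · refine interpErr_truncPow_eq_zero_of_le (by rw [hX]; have := hn i; omega) ?_ fun a ha => ?_
      · have := (neg_le_abs (x i)).trans (hr' _ (Finset.mem_insert_self _ _)); linarith
      · have := (neg_le_abs a).trans (hr' _ (Finset.mem_insert_of_mem ha)); linarith
  choose r hr using h1
  obtain ⟨R, hR⟩ := (Set.finite_range r).bddAbove
  exact ⟨R, fun i t ht => hr i t ((hR ⟨i, rfl⟩).trans_lt ht)⟩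

theorem continuous_interpErr_truncPow_left {n : ℕ} (hn : 2 ≤ n) (X : Finset ℝ) (x : ℝ) :
    Continuous fun t => interpErr X (truncPow (n - 1) t) x :=
  (continuous_interpErr_truncPow X (k := n - 1) (by omega)).comp
    (continuous_id.prodMk continuous_const)

theorem integrable_gridDiff_mul_prod {d : ℕ} {n : Fin d → ℕ} (hn : ∀ i, 2 ≤ n i)
    {X : Fin d → Finset ℝ} (hX : ∀ i, (X i).card = n i) (h : ℝ)
    {f : (Fin d → ℝ) → ℝ} (hf : Continuous f) (x : Fin d → ℝ) :
    Integrable fun A : Fin d → ℝ =>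
      gridDiff n h f A * ∏ i, interpErr (X i) (truncPow (n i - 1) (A i)) (x i) := by
  obtain ⟨r, hr⟩ := exists_forall_interpErr_eq_zero hn hX x
  exact integrable_mul_prod (continuous_gridDiff n h hf)
    (φ := fun i t => interpErr (X i) (truncPow (n i - 1) t) (x i))
    (fun i => continuous_interpErr_truncPow_left (hn i) _ _) hr

/-- A discrete Peano formula, obtained by summation by parts: translating the variable in each term
of the grid difference moves the difference from `f` onto the kernels, where it turns truncated
powers into B-splines. No smoothness of `f` is used. -/
theorem integral_gridDiff_mul_prod {d : ℕ} {n : Fin d → ℕ} (hn : ∀ i, 2 ≤ n i)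
    {X : Fin d → Finset ℝ} (hX : ∀ i, (X i).card = n i) {h : ℝ} (hh : 0 < h)
    {f : (Fin d → ℝ) → ℝ} (hf : Continuous f) (x : Fin d → ℝ) :
    ∫ A : Fin d → ℝ, gridDiff n h f A * ∏ i, interpErr (X i) (truncPow (n i - 1) (A i)) (x i) =
      listErr X (List.finRange d) (mollify n h f) x := by
  obtain ⟨r, hr⟩ := exists_forall_interpErr_eq_zero hn hX x
  set K : Fin d → ℝ → ℝ := fun i t => interpErr (X i) (truncPow (n i - 1) t) (x i) with hK
  have hKc : ∀ i, Continuous (K i) := fun i => continuous_interpErr_truncPow_left (hn i) _ _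
  have hR := (listErr_integral_prod (μ := (volume : Measure (Fin d → ℝ))) X (f := f)
    (φ := fun i v p => bspline (n i) h (v i - p))
    (fun p => integrable_mul_prod_bspline hn hh hf p) (List.nodup_finRange d) x).2
  simp only [List.mem_finRange, if_true] at hR
  rw [show mollify n h f = fun p => ∫ v, f v * ∏ i, bspline (n i) h (v i - p i) from rfl, hR]
  have h1 : ∀ (j : (i : Fin d) → Fin (n i + 1)) (A : Fin d → ℝ),
      f (fun i => A i + (j i : ℝ) * h) * ∏ i, K i (A i) =
        (fun v => f v * ∏ i, K i (v i - (j i : ℝ) * h)) (A + fun i => (j i : ℝ) * h) := by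
    intro j A; simp only [Pi.add_apply, add_sub_cancel_right]; rfl
  have hI : ∀ j : (i : Fin d) → Fin (n i + 1),
      Integrable fun v : Fin d → ℝ => f v * ∏ i, K i (v i - (j i : ℝ) * h) := by
    intro j
    have h2 : Integrable fun A : Fin d → ℝ => f (fun i => A i + (j i : ℝ) * h) * ∏ i, K i (A i) :=
      integrable_mul_prod (g := fun A => f fun i => A i + (j i : ℝ) * h)
        (hf.comp (by fun_prop)) hKc hr
    simp_rw [h1] at h2
    simpa using h2.comp_sub_right (fun i => (j i : ℝ) * h)
  have h3 : ∀ A : Fin d → ℝ, gridDiff n h f A * ∏ i, K i (A i) =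
      ∑ j : (i : Fin d) → Fin (n i + 1), (∏ i, gridWeight (n i) h (j i)) *
        (fun v => f v * ∏ i, K i (v i - (j i : ℝ) * h)) (A + fun i => (j i : ℝ) * h) := by
    intro A
    simp only [gridDiff, Finset.sum_mul, mul_assoc, ← h1]
  change ∫ A : Fin d → ℝ, gridDiff n h f A * ∏ i, K i (A i) = _
  simp_rw [h3]
  rw [integral_finsetSum _ fun j _ => ((hI j).comp_add_right _).const_mul _]
  have h5 : ∀ j : (i : Fin d) → Fin (n i + 1),
      ∫ A : Fin d → ℝ, (∏ i, gridWeight (n i) h (j i)) *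
        (fun v : Fin d → ℝ => f v * ∏ i, K i (v i - (j i : ℝ) * h)) (A + fun i => (j i : ℝ) * h) =
      ∫ v : Fin d → ℝ, (∏ i, gridWeight (n i) h (j i)) *
        (f v * ∏ i, K i (v i - (j i : ℝ) * h)) := fun j => by
    rw [integral_const_mul, integral_const_mul, integral_add_right_eq_self
      fun v : Fin d → ℝ => f v * ∏ i, K i (v i - (j i : ℝ) * h)]
  simp_rw [h5]
  rw [← integral_finsetSum _ fun j _ => (hI j).const_mul _]
  congr 1
  funext v
  -- The knot and the variable trade places here: `m * h - (v i - p) = p - (v i - m * h)`.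
  have h4 : ∀ i, interpErr (X i) (fun p => bspline (n i) h (v i - p)) (x i) =
      ∑ m : Fin (n i + 1), gridWeight (n i) h m * K i (v i - (m : ℝ) * h) := by
    intro i
    rw [hK, ← interpErr_sum]
    congr 1
    funext p
    refine Finset.sum_congr rfl fun m _ => ?_
    congr 1
    unfold truncPow
    congr 1
    · exact propext ⟨fun h => by linarith, fun h => by linarith⟩
    · ring
  simp_rw [h4, Finset.prod_univ_sum, Fintype.piFinset_univ, Finset.prod_mul_distrib, Finset.mul_sum]
  exact Finset.sum_congr rfl fun j _ => by ring

theorem tendsto_listErr {d : ℕ} (X : Fin d → Finset ℝ) {ι : Type*} {l : Filter ι}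
    {g : ι → (Fin d → ℝ) → ℝ} {g₀ : (Fin d → ℝ) → ℝ}
    (h : ∀ x, Tendsto (fun k => g k x) l (𝓝 (g₀ x))) (L : List (Fin d)) (x : Fin d → ℝ) :
    Tendsto (fun k => listErr X L (g k) x) l (𝓝 (listErr X L g₀ x)) := by
  induction L generalizing x with
  | nil => exact h x
  | cons i L ih =>
    exact (ih x).sub (tendsto_finsetSum _ fun a _ => (ih _).const_mul _)

theorem continuous_listErr {d : ℕ} (X : Fin d → Finset ℝ) {g : (Fin d → ℝ) → ℝ} (hg : Continuous g)
    (L : List (Fin d)) : Continuous (listErr X L g) := by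
  induction L with
  | nil => exact hg
  | cons i L ih =>
    refine Continuous.sub ih (continuous_finsetSum _ fun a _ => Continuous.mul ?_ ?_)
    · exact (Polynomial.continuous _).comp (continuous_apply i)
    · exact ih.comp (continuous_id.update i continuous_const)

theorem listErr_const_mul {d : ℕ} (X : Fin d → Finset ℝ) (c : ℝ) (g : (Fin d → ℝ) → ℝ)
    (L : List (Fin d)) (x : Fin d → ℝ) :
    listErr X L (fun x => c * g x) x = c * listErr X L g x := by
  induction L generalizing x with
  | nil => rfl
  | cons i L ih =>
    change listErr X L (fun x => c * g x) x - _ = c * (listErr X L g x - _)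
    simp only [ih, mul_sub, Finset.mul_sum]
    congr 1
    refine Finset.sum_congr rfl fun a _ => ?_
    rw [mul_left_comm]
    exact congrArg _ (ih _)

/-! ### Signed weights with vanishing moments -/

/-- The weight `W` on the measure `m` takes the values `±1`, the polynomials of degree less than `n`
are integrable and their weighted integrals vanish. -/
structure VanishingMoments (n : ℕ) (m : Measure ℝ) (W : ℝ → ℝ) : Prop where
  measurable : Measurable W
  abs_eq_one : ∀ x, |W x| = 1
  integrable : Integrable (fun x : ℝ => |x| ^ (n - 1)) m
  integral_eq_zero : ∀ P : Polynomial ℝ, P.degree < n → ∫ x, P.eval x * W x ∂m = 0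

theorem one_add_abs_pow_le {k N : ℕ} (h : k ≤ N) (x : ℝ) : |x| ^ k ≤ 1 + |x| ^ N := by
  rcases le_total |x| 1 with hx | hx
  · have := pow_le_one₀ (n := k) (abs_nonneg x) hx
    have := pow_nonneg (abs_nonneg x) N
    linarith
  · have := pow_le_pow_right₀ hx h
    linarith

theorem integrable_abs_pow_of_le {m : Measure ℝ} [IsFiniteMeasure m] {k N : ℕ} (h : k ≤ N)
    (hN : Integrable (fun x : ℝ => |x| ^ N) m) : Integrable (fun x : ℝ => |x| ^ k) m := by
  refine ((integrable_const (1 : ℝ)).add hN).mono' (by fun_prop) (Eventually.of_forall fun x => ?_)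
  rw [Real.norm_of_nonneg (by positivity)]
  exact one_add_abs_pow_le h x

theorem integrable_polynomial {m : Measure ℝ} [IsFiniteMeasure m] {N : ℕ}
    (hN : Integrable (fun x : ℝ => |x| ^ N) m) {P : Polynomial ℝ} (hP : P.natDegree ≤ N) :
    Integrable (fun x => P.eval x) m := by
  simp_rw [Polynomial.eval_eq_sum_range]
  refine integrable_finsetSum _ fun k hk => Integrable.const_mul ?_ _
  refine (integrable_abs_pow_of_le (k := k) (by have := Finset.mem_range.1 hk; omega) hN).mono'
    (by fun_prop) (Eventually.of_forall fun x => ?_)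
  rw [norm_pow, Real.norm_eq_abs]

theorem VanishingMoments.integrable_eval {n : ℕ} {m : Measure ℝ} [IsFiniteMeasure m] {W : ℝ → ℝ}
    (h : VanishingMoments n m W) {P : Polynomial ℝ} (hP : P.degree < n) :
    Integrable (fun x => P.eval x) m := by
  refine integrable_polynomial h.integrable ?_
  rcases eq_or_ne P 0 with rfl | h0
  · simp
  · have := (Polynomial.natDegree_lt_iff_degree_lt h0).2 hP; omega

/-- If fewer than `n` points satisfied `p`, the polynomial interpolating `W` at them would have
degree less than `n` and agree with `W` almost everywhere; its weighted integral, which vanishes,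
would be the integral of `W ^ 2 = 1`, that is, the total mass. -/
theorem VanishingMoments.exists_nodes {n : ℕ} {m : Measure ℝ} [IsFiniteMeasure m] {W : ℝ → ℝ}
    (h : VanishingMoments n m W) (hm : m ≠ 0) {p : ℝ → Prop} (hp : ∀ᵐ x ∂m, p x) :
    ∃ X : Finset ℝ, X.card = n ∧ ∀ x ∈ X, p x := by
  by_cases hS : {x | p x}.Infinite
  · obtain ⟨X, hX, hc⟩ := hS.exists_subset_card_eq n
    exact ⟨X, hc, hX⟩
  rw [Set.not_infinite] at hS
  by_cases hc : n ≤ hS.toFinset.card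
  · obtain ⟨X, hX, hc⟩ := Finset.exists_subset_card_eq hc
    exact ⟨X, hc, fun x hx => hS.mem_toFinset.1 (hX hx)⟩
  exfalso
  have hd := Lagrange.degree_interpolate_lt (s := hS.toFinset) (v := id) W Function.injective_id.injOn
  have h0 := h.integral_eq_zero _ (hd.trans (by exact_mod_cast not_le.1 hc))
  have h1 : ∫ x, (Lagrange.interpolate hS.toFinset id W).eval x * W x ∂m = ∫ x, (1 : ℝ) ∂m := by
    refine integral_congr_ae ?_
    filter_upwards [hp] with x hx
    have := Lagrange.eval_interpolate_at_node (s := hS.toFinset) (v := id) W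
      Function.injective_id.injOn (hS.mem_toFinset.2 hx)
    simp only [id] at this
    rw [this, ← abs_mul_abs_self, h.abs_eq_one, one_mul]
  rw [h1] at h0
  simp only [integral_const, smul_eq_mul, mul_one] at h0
  exact hm (Measure.measure_univ_eq_zero.1 ((measureReal_eq_zero_iff).1 h0))

theorem measurable_prod_weight {d : ℕ} {W : Fin d → ℝ → ℝ} (hW : ∀ i, Measurable (W i)) :
    Measurable fun x : Fin d → ℝ => ∏ i, W i (x i) :=
  Finset.measurable_prod _ fun i _ => (hW i).comp (measurable_pi_apply i)

theorem integrable_mul_weight {α : Type*} [MeasurableSpace α] {μ : Measure α} {g W : α → ℝ}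
    (hg : Integrable g μ) (hW : Measurable W) (hW1 : ∀ x, |W x| = 1) :
    Integrable (fun x => g x * W x) μ :=
  hg.mul_bdd (c := 1) hW.aestronglyMeasurable (Eventually.of_forall fun x => (hW1 x).le)

theorem abs_prod_weight {d : ℕ} {W : Fin d → ℝ → ℝ} (hW : ∀ i x, |W i x| = 1) (x : Fin d → ℝ) :
    |∏ i, W i (x i)| = 1 := by
  rw [Finset.abs_prod]; exact Finset.prod_eq_one fun i _ => hW i _

/-! ### Interpolation errors under the weighted integral -/

section
variable {d : ℕ} {n : Fin d → ℕ} {m : Fin d → Measure ℝ} [∀ i, IsFiniteMeasure (m i)]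
  {W : Fin d → ℝ → ℝ}

/-- Almost all sections of an integrable function are negligible for weights with vanishing
moments, when multiplied by a polynomial in the frozen variable. -/
theorem ae_integrable_update (hv : ∀ i, VanishingMoments (n i) (m i) (W i)) (i : Fin d)
    {g : (Fin d → ℝ) → ℝ} (hg : Integrable g (Measure.pi m)) :
    ∀ᵐ a ∂(m i), ∀ P : Polynomial ℝ, P.degree < n i →
      Integrable (fun x => P.eval (x i) * g (Function.update x i a)) (Measure.pi m) ∧
      ∫ x, P.eval (x i) * g (Function.update x i a) * ∏ j, W j (x j) ∂(Measure.pi m) = 0 := by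
  cases d with
  | zero => exact i.elim0
  | succ d =>
    have hmp := measurePreserving_piFinSuccAbove m i
    set e := MeasurableEquiv.piFinSuccAbove (fun _ : Fin (d + 1) => ℝ) i with he
    have hg' : Integrable (fun q : ℝ × (Fin d → ℝ) => g (i.insertNth q.1 q.2))
        ((m i).prod (Measure.pi fun j => m (i.succAbove j))) := by
      rw [← hmp.integrable_comp_emb e.measurableEmbedding]
      refine hg.congr (Eventually.of_forall fun x => ?_)
      simp [he, MeasurableEquiv.piFinSuccAbove, Fin.insertNthEquiv]
    filter_upwards [hg'.prod_right_ae] with a ha P hP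
    have hup : ∀ x : Fin (d + 1) → ℝ, Function.update x i a = i.insertNth a (e x).2 := by
      intro x
      simp [he, MeasurableEquiv.piFinSuccAbove, Fin.insertNthEquiv]
    have hfst : ∀ x : Fin (d + 1) → ℝ, x i = (e x).1 := fun x => rfl
    have hsnd : ∀ (x : Fin (d + 1) → ℝ) j, x (i.succAbove j) = (e x).2 j := fun x j => rfl
    constructor
    · have h1 := ((hv i).integrable_eval hP).mul_prod ha
      rw [← hmp.integrable_comp_emb e.measurableEmbedding] at h1
      refine h1.congr (Eventually.of_forall fun x => ?_)
      simp only [Function.comp, hup, hfst]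
    · have h2 : ∀ x : Fin (d + 1) → ℝ,
          P.eval (x i) * g (Function.update x i a) * ∏ j, W j (x j) =
          (fun q : ℝ × (Fin d → ℝ) => (P.eval q.1 * W i q.1) *
            (g (i.insertNth a q.2) * ∏ j, W (i.succAbove j) (q.2 j))) (e x) := by
        intro x
        rw [Fin.prod_univ_succAbove _ i]
        simp only [hup, hfst, hsnd]
        ring
      rw [integral_congr_ae (Eventually.of_forall h2),
        hmp.integral_comp e.measurableEmbedding (fun q : ℝ × (Fin d → ℝ) =>
          (P.eval q.1 * W i q.1) * (g (i.insertNth a q.2) * ∏ j, W (i.succAbove j) (q.2 j))),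
        integral_prod_mul
        (fun t : ℝ => P.eval t * W i t)
        (fun q : Fin d → ℝ => g (i.insertNth a q) * ∏ j, W (i.succAbove j) (q j)),
        (hv i).integral_eq_zero P hP, zero_mul]

theorem degree_basis_lt {X : Finset ℝ} {a : ℝ} (ha : a ∈ X) :
    (Lagrange.basis X id a).degree < X.card := by
  rw [Lagrange.degree_basis Function.injective_id.injOn ha]
  exact_mod_cast Nat.sub_lt (Finset.card_pos.2 ⟨a, ha⟩) one_pos

/-- Each interpolation term is a polynomial of degree less than `n i` in the frozen coordinate times
a section of `g`, so its weighted integral vanishes. As `g` is only integrable, the nodes must avoid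
the null set of bad sections. -/
theorem exists_nodes_coordErr (hv : ∀ i, VanishingMoments (n i) (m i) (W i)) (hm : ∀ i, m i ≠ 0)
    (i : Fin d) {g : (Fin d → ℝ) → ℝ} (hg : Integrable g (Measure.pi m)) :
    ∃ X : Finset ℝ, X.card = n i ∧ ∀ Y : Fin d → Finset ℝ, Y i = X →
      Integrable (coordErr Y i g) (Measure.pi m) ∧
      ∫ x, coordErr Y i g x * ∏ j, W j (x j) ∂(Measure.pi m) =
        ∫ x, g x * ∏ j, W j (x j) ∂(Measure.pi m) := by
  obtain ⟨X, hX, hXp⟩ := (hv i).exists_nodes (hm i) (ae_integrable_update hv i hg)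
  refine ⟨X, hX, fun Y hY => ?_⟩
  subst hY
  have hW := measurable_prod_weight fun i => (hv i).measurable
  have hW1 := abs_prod_weight fun i => (hv i).abs_eq_one
  have h1 := fun a ha => hXp a ha (Lagrange.basis (Y i) id a) (hX ▸ degree_basis_lt ha)
  have h2 := integrable_finsetSum (Y i) fun a ha => (h1 a ha).1
  refine ⟨hg.sub h2, ?_⟩
  simp only [coordErr, sub_mul, Finset.sum_mul]
  have h3 := fun a ha => integrable_mul_weight (h1 a ha).1 hW hW1
  rw [integral_sub (integrable_mul_weight hg hW hW1) (integrable_finsetSum _ h3),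
    integral_finsetSum _ h3, Finset.sum_eq_zero fun a ha => (h1 a ha).2, sub_zero]

theorem listErr_congr {X Y : Fin d → Finset ℝ} {l : List (Fin d)} (h : ∀ i ∈ l, X i = Y i)
    (g : (Fin d → ℝ) → ℝ) : listErr X l g = listErr Y l g := by
  induction l with
  | nil => rfl
  | cons i l ih =>
    have h1 := ih fun j hj => h j (List.mem_cons_of_mem _ hj)
    have h2 := h i List.mem_cons_self
    funext x
    change coordErr X i (listErr X l g) x = coordErr Y i (listErr Y l g) x
    rw [h1]
    simp only [coordErr, h2]

/-- The nodes are chosen one coordinate at a time, because the admissible nodes depend on the error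
function already formed. -/
theorem exists_nodes_listErr (hv : ∀ i, VanishingMoments (n i) (m i) (W i)) (hm : ∀ i, m i ≠ 0)
    {g : (Fin d → ℝ) → ℝ} (hg : Integrable g (Measure.pi m)) {l : List (Fin d)} (hl : l.Nodup) :
    ∃ X : Fin d → Finset ℝ, (∀ i, (X i).card = n i) ∧
      Integrable (listErr X l g) (Measure.pi m) ∧
      ∫ x, listErr X l g x * ∏ j, W j (x j) ∂(Measure.pi m) =
        ∫ x, g x * ∏ j, W j (x j) ∂(Measure.pi m) := by
  induction l with
  | nil =>
    choose X hX using fun i => (hv i).exists_nodes (hm i) (p := fun _ => True) (by simp)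
    exact ⟨X, fun i => (hX i).1, hg, rfl⟩
  | cons i l ih =>
    obtain ⟨X, hX, h1, h2⟩ := ih (List.nodup_cons.1 hl).2
    have hi := (List.nodup_cons.1 hl).1
    obtain ⟨Z, hZ, h3⟩ := exists_nodes_coordErr hv hm i h1
    have hY := h3 (Function.update X i Z) (Function.update_self ..)
    have hl' : listErr (Function.update X i Z) l g = listErr X l g :=
      listErr_congr (fun j hj => by
        rw [Function.update_of_ne]
        rintro rfl
        exact hi hj) g
    refine ⟨Function.update X i Z, fun j => ?_, ?_⟩
    · by_cases hj : j = i
      · subst hj; rw [Function.update_self, hZ]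
      · rw [Function.update_of_ne hj, hX]
    · change Integrable (coordErr _ i (listErr _ l g)) _ ∧
        ∫ x, coordErr _ i (listErr _ l g) x * _ ∂_ = _
      rw [hl', ← h2]
      exact hY
end

/-! ### Positivity of the integrals of box-convex functions -/

/-- The cube `[-R, R]ᵈ`. -/
def cube (d : ℕ) (R : ℝ) : Set (Fin d → ℝ) := Set.univ.pi fun _ => Set.Icc (-R) R

theorem mem_cube {d : ℕ} {R : ℝ} {x : Fin d → ℝ} : x ∈ cube d R ↔ ∀ i, |x i| ≤ R := by
  simp only [cube, Set.mem_pi, Set.mem_univ, true_implies, Set.mem_Icc, abs_le]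

theorem isCompact_cube (d : ℕ) (R : ℝ) : IsCompact (cube d R) :=
  isCompact_univ_pi fun _ => isCompact_Icc

theorem measurableSet_cube (d : ℕ) (R : ℝ) : MeasurableSet (cube d R) :=
  (isCompact_cube d R).measurableSet

/-- The integrand in the duality between grid differences and interpolation errors. -/
def dualKernel {d : ℕ} (n : Fin d → ℕ) (X : Fin d → Finset ℝ) (h : ℝ) (f : (Fin d → ℝ) → ℝ)
    (x A : Fin d → ℝ) : ℝ :=
  gridDiff n h f A * ∏ i, interpErr (X i) (truncPow (n i - 1) (A i)) (x i)

/-- A bound for `interpErr X (truncPow k A) x`, valid for `|A| ≤ R`. -/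
def interpErrBound (X : Finset ℝ) (k : ℕ) (R x : ℝ) : ℝ :=
  (|x| + R) ^ k + ∑ a ∈ X, |(Lagrange.basis X id a).eval x| * (|a| + R) ^ k

theorem truncPow_le {k : ℕ} {A R : ℝ} (hA : |A| ≤ R) (x : ℝ) : truncPow k A x ≤ (|x| + R) ^ k := by
  have hR := (abs_nonneg A).trans hA
  unfold truncPow; split_ifs with h
  · refine pow_le_pow_left₀ (by linarith) ?_ _
    linarith [le_abs_self x, neg_le_abs A]
  · positivity

theorem abs_interpErr_le (X : Finset ℝ) (k : ℕ) {A R : ℝ} (hA : |A| ≤ R) (x : ℝ) :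
    |interpErr X (truncPow k A) x| ≤ interpErrBound X k R x := by
  refine (abs_sub _ _).trans (add_le_add ?_ ((Finset.abs_sum_le_sum_abs _ _).trans
    (Finset.sum_le_sum fun a _ => ?_)))
  · rw [abs_of_nonneg (truncPow_nonneg _ _ _)]; exact truncPow_le hA x
  · rw [abs_mul, abs_of_nonneg (truncPow_nonneg _ _ _)]
    exact mul_le_mul_of_nonneg_left (truncPow_le hA a) (abs_nonneg _)

theorem interpErrBound_nonneg (X : Finset ℝ) (k : ℕ) {R : ℝ} (hR : 0 ≤ R) (x : ℝ) :
    0 ≤ interpErrBound X k R x := by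
  unfold interpErrBound; positivity

theorem integrable_abs_add_pow {m : Measure ℝ} [IsFiniteMeasure m] {k : ℕ}
    (hm : Integrable (fun x : ℝ => |x| ^ k) m) {R : ℝ} (hR : 0 ≤ R) :
    Integrable (fun x : ℝ => (|x| + R) ^ k) m := by
  refine ((hm.add (integrable_const (R ^ k))).const_mul (2 ^ (k - 1))).mono' (by fun_prop)
    (Eventually.of_forall fun x => ?_)
  rw [Real.norm_of_nonneg (by positivity)]
  exact add_pow_le (abs_nonneg x) hR k

theorem VanishingMoments.integrable_interpErrBound {n : ℕ} {m : Measure ℝ} [IsFiniteMeasure m]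
    {W : ℝ → ℝ} (h : VanishingMoments n m W) {X : Finset ℝ} (hX : X.card = n) {R : ℝ} (hR : 0 ≤ R) :
    Integrable (interpErrBound X (n - 1) R) m :=
  (integrable_abs_add_pow h.integrable hR).add (integrable_finsetSum _ fun _ ha =>
    ((h.integrable_eval (hX ▸ degree_basis_lt ha)).abs.mul_const _))

theorem measurable_truncPow (k : ℕ) : Measurable fun p : ℝ × ℝ => truncPow k p.1 p.2 :=
  Measurable.ite (measurableSet_le measurable_fst measurable_snd) (by fun_prop) measurable_const

theorem integrable_truncPow_of_le {m : Measure ℝ} [IsFiniteMeasure m] {N k : ℕ} (hk : k ≤ N)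
    (hm : Integrable (fun x : ℝ => |x| ^ N) m) (A : ℝ) : Integrable (truncPow k A) m := by
  refine (integrable_abs_add_pow (integrable_abs_pow_of_le hk hm) (abs_nonneg A)).mono'
    ((measurable_truncPow _).comp (by fun_prop : Measurable fun x : ℝ => (A, x))).aestronglyMeasurable
    (Eventually.of_forall fun x => ?_)
  rw [Real.norm_of_nonneg (truncPow_nonneg _ _ _)]
  exact truncPow_le le_rfl x

theorem VanishingMoments.integrable_truncPow {n : ℕ} {m : Measure ℝ} [IsFiniteMeasure m]
    {W : ℝ → ℝ} (h : VanishingMoments n m W) (A : ℝ) : Integrable (truncPow (n - 1) A) m :=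
  integrable_truncPow_of_le le_rfl h.integrable A

theorem VanishingMoments.integral_interpErr {n : ℕ} {m : Measure ℝ} [IsFiniteMeasure m]
    {W : ℝ → ℝ} (h : VanishingMoments n m W) {X : Finset ℝ} (hX : X.card = n) (A : ℝ) :
    ∫ x, interpErr X (truncPow (n - 1) A) x * W x ∂m = ∫ x, truncPow (n - 1) A x * W x ∂m := by
  have h1 : ∀ a ∈ X, Integrable (fun x => (Lagrange.basis X id a).eval x * truncPow (n - 1) A a * W x)
      m := fun a ha => integrable_mul_weight ((h.integrable_eval (hX ▸ degree_basis_lt ha)).mul_const _)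
    h.measurable h.abs_eq_one
  simp only [interpErr, sub_mul, Finset.sum_mul]
  rw [integral_sub (integrable_mul_weight (h.integrable_truncPow A) h.measurable h.abs_eq_one)
    (integrable_finsetSum _ h1), integral_finsetSum _ h1, Finset.sum_eq_zero, sub_zero]
  intro a ha
  simp_rw [mul_right_comm _ (truncPow (n - 1) A a)]
  rw [integral_mul_const, h.integral_eq_zero _ (hX ▸ degree_basis_lt ha), zero_mul]

theorem continuous_dualKernel {d : ℕ} {n : Fin d → ℕ} (hn : ∀ i, 2 ≤ n i) {f : (Fin d → ℝ) → ℝ} (hf : Continuous f)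
    (X : Fin d → Finset ℝ) (h : ℝ) :
    Continuous fun p : (Fin d → ℝ) × (Fin d → ℝ) => dualKernel n X h f p.1 p.2 :=
  ((continuous_gridDiff n h hf).comp continuous_snd).mul (continuous_finsetProd _ fun i _ =>
    (continuous_interpErr_truncPow (X i) (k := n i - 1) (by have := hn i; omega)).comp
      (by fun_prop : Continuous fun p : (Fin d → ℝ) × (Fin d → ℝ) => (p.2 i, p.1 i)))

theorem setIntegral_cube_dualKernel {d : ℕ} {n : Fin d → ℕ} (hn : ∀ i, 2 ≤ n i) {f : (Fin d → ℝ) → ℝ} (hf : Continuous f)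
    {X : Fin d → Finset ℝ} (hX : ∀ i, (X i).card = n i)
    {h : ℝ} (hh : 0 < h) {R : ℝ} (hXR : ∀ i, ∀ a ∈ X i, |a| ≤ R)
    {x : Fin d → ℝ} (hx : x ∈ cube d R) :
    ∫ A in cube d R, dualKernel n X h f x A =
      listErr X (List.finRange d) (mollify n h f) x := by
  rw [← integral_gridDiff_mul_prod hn hX hh hf x]
  refine setIntegral_eq_integral_of_forall_compl_eq_zero fun A hA => ?_
  rw [mem_cube] at hA hx
  push Not at hA
  obtain ⟨i, hi⟩ := hA
  refine mul_eq_zero_of_right _ (Finset.prod_eq_zero (Finset.mem_univ i) ?_)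
  rcases lt_abs.1 hi with h | h
  · exact interpErr_truncPow_eq_zero_of_lt ((le_abs_self _).trans_lt ((hx i).trans_lt h))
      fun a ha => (le_abs_self _).trans_lt ((hXR i a ha).trans_lt h)
  · refine interpErr_truncPow_eq_zero_of_le (by rw [hX]; have := hn i; omega) ?_ fun a ha => ?_
    · have := (neg_le_abs (x i)).trans (hx i); linarith
    · have := (neg_le_abs a).trans (hXR i a ha); linarith

theorem abs_dualKernel {d : ℕ} {n : Fin d → ℕ} (hn : ∀ i, 2 ≤ n i) {f : (Fin d → ℝ) → ℝ} (hbox : IsBoxConvex n f)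
    {X : Fin d → Finset ℝ} (hX : ∀ i, (X i).card = n i)
    {h : ℝ} (hh : 0 < h) (x A : Fin d → ℝ) :
    |dualKernel n X h f x A| =
      (∏ i, (SignType.sign (∏ a ∈ X i, (x i - a)) : ℝ)) * dualKernel n X h f x A := by
  rw [dualKernel, abs_mul, abs_of_nonneg (gridDiff_nonneg hh hbox A), Finset.abs_prod]
  simp_rw [fun i => abs_interpErr_truncPow (k := n i - 1) (X := X i)
    (by rw [hX]; have := hn i; omega) (A i) (x i), Finset.prod_mul_distrib]
  ring

/-- For fixed `x` the integrand has one sign in `A`, so the modulus of a partial integral is at most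
that of the full one. This controls the truncation outside the cube. -/
theorem abs_setIntegral_dualKernel_le {d : ℕ} {n : Fin d → ℕ} (hn : ∀ i, 2 ≤ n i) {f : (Fin d → ℝ) → ℝ} (hf : Continuous f) (hbox : IsBoxConvex n f)
    {X : Fin d → Finset ℝ} (hX : ∀ i, (X i).card = n i)
    {h : ℝ} (hh : 0 < h) (s : Set (Fin d → ℝ)) (x : Fin d → ℝ) :
    |∫ A in s, dualKernel n X h f x A| ≤
      |listErr X (List.finRange d) (mollify n h f) x| := by
  have hI : Integrable (dualKernel n X h f x) := integrable_gridDiff_mul_prod hn hX h hf x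
  calc |∫ A in s, dualKernel n X h f x A|
      ≤ ∫ A in s, |dualKernel n X h f x A| := abs_integral_le_integral_abs
    _ ≤ ∫ A, |dualKernel n X h f x A| :=
        setIntegral_le_integral hI.abs (Eventually.of_forall fun _ => abs_nonneg _)
    _ = (∏ i, (SignType.sign (∏ a ∈ X i, (x i - a)) : ℝ)) *
          listErr X (List.finRange d) (mollify n h f) x := by
        simp_rw [abs_dualKernel hn hbox hX hh]
        rw [integral_const_mul]
        congr 1
        exact integral_gridDiff_mul_prod hn hX hh hf x
    _ ≤ |(∏ i, (SignType.sign (∏ a ∈ X i, (x i - a)) : ℝ))| *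
          |listErr X (List.finRange d) (mollify n h f) x| := by
        rw [← abs_mul]; exact le_abs_self _
    _ ≤ _ := by
        refine mul_le_of_le_one_left (abs_nonneg _) ?_
        rw [Finset.abs_prod]
        refine Finset.prod_le_one (fun _ _ => abs_nonneg _) fun i _ => ?_
        rcases SignType.sign (∏ a ∈ X i, (x i - a)) <;> simp

/-- With suitable nodes and evaluation point, the kernel of the duality formula is nonnegative
everywhere and at least `1` on the cube. The mass is then bounded by an interpolation error of the
mollification, which converges as `h → 0`. -/
theorem bddAbove_setIntegral_gridDiff {d : ℕ} {n : Fin d → ℕ} (hn : ∀ i, 2 ≤ n i) {f : (Fin d → ℝ) → ℝ} (hf : Continuous f) (hbox : IsBoxConvex n f)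
    (R : ℝ) {h : ℕ → ℝ} (hh : ∀ k, 0 < h k)
    (h0 : Tendsto h atTop (𝓝 0)) :
    ∃ M : ℝ, 0 ≤ M ∧ ∀ k, ∫ A in cube d R, gridDiff n (h k) f A ≤ M := by
  -- All nodes lie to the left of the cube, so for knots in the cube the error at a point to the
  -- right is the plain power `(z i - A i) ^ (n i - 1)`.
  set Y : Fin d → Finset ℝ := fun i => (Finset.range (n i)).image fun j : ℕ => -R - 1 - (j : ℝ) with hY
  have hYc : ∀ i, (Y i).card = n i := fun i => by
    rw [hY, Finset.card_image_of_injective, Finset.card_range]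
    intro a b hab
    exact_mod_cast (sub_right_injective hab : (a : ℝ) = b)
  have hYlt : ∀ i, ∀ a ∈ Y i, a < -R ∧ a < -R - 1 + 1 := by
    intro i a ha
    obtain ⟨j, _, rfl⟩ := Finset.mem_image.1 ha
    have : (0 : ℝ) ≤ (j : ℝ) := j.cast_nonneg
    constructor <;> linarith
  -- At distance at least `1` from every knot in `[-R, R]`; the modulus is taken because `R` may be
  -- negative.
  set z : Fin d → ℝ := fun _ => |R| + 1 with hz
  have hKnn : ∀ i t, 0 ≤ interpErr (Y i) (truncPow (n i - 1) t) (z i) := by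
    intro i t
    have h1 := prod_mul_interpErr_truncPow_nonneg (X := Y i) (k := n i - 1)
      (by rw [hYc i]; have := hn i; omega) t (z i)
    refine nonneg_of_mul_nonneg_right h1 (Finset.prod_pos fun a ha => ?_)
    have := (hYlt i a ha).1
    have := neg_le_abs R
    simp only [hz]
    linarith
  have hlim := tendsto_listErr Y
    (fun x => (tendsto_mollify hn hf x).comp
      (tendsto_nhdsWithin_iff.2 ⟨h0, Eventually.of_forall hh⟩)) (List.finRange d) z
  obtain ⟨M, hM⟩ := hlim.bddAbove_range
  refine ⟨max M 0, le_max_right _ _, fun k => le_trans ?_ ((hM ⟨k, rfl⟩).trans (le_max_left _ _))⟩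
  have hD := gridDiff_nonneg (hh k) hbox
  have hI := integrable_gridDiff_mul_prod hn hYc (h k) hf z
  calc ∫ A in cube d R, gridDiff n (h k) f A
      ≤ ∫ A in cube d R, gridDiff n (h k) f A *
          ∏ i, interpErr (Y i) (truncPow (n i - 1) (A i)) (z i) := by
        refine setIntegral_mono_on ((continuous_gridDiff n (h k) hf).continuousOn.integrableOn_compact
          (isCompact_cube d R)) hI.integrableOn (measurableSet_cube d R) fun A hA => ?_
        refine le_mul_of_one_le_right (hD A) ?_
        rw [mem_cube] at hA
        rw [← Finset.prod_const_one (s := (Finset.univ : Finset (Fin d)))]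
        refine Finset.prod_le_prod (fun _ _ => zero_le_one) fun i _ => ?_
        have h1 := abs_le.1 (hA i)
        have h2 := le_abs_self R
        rw [interpErr_truncPow_of_lt (by simp only [hz]; linarith)
          fun a ha => (hYlt i a ha).1.trans_le h1.1]
        refine one_le_pow₀ ?_
        simp only [hz]
        linarith
    _ ≤ ∫ A, gridDiff n (h k) f A *
          ∏ i, interpErr (Y i) (truncPow (n i - 1) (A i)) (z i) :=
        setIntegral_le_integral hI (Eventually.of_forall fun A =>
          mul_nonneg (hD A) (Finset.prod_nonneg fun i _ => hKnn i _))
    _ = _ := integral_gridDiff_mul_prod hn hYc (hh k) hf z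

theorem abs_setIntegral_cube_dualKernel_le {d : ℕ} {n : Fin d → ℕ} {f : (Fin d → ℝ) → ℝ} (hf : Continuous f) (hbox : IsBoxConvex n f)
    {R M : ℝ} {h : ℝ} (hh : 0 < h)
    (hM : ∫ A in cube d R, gridDiff n h f A ≤ M) (hR : 0 ≤ R) (X : Fin d → Finset ℝ)
    (x : Fin d → ℝ) :
    |∫ A in cube d R, dualKernel n X h f x A| ≤
      M * ∏ i, interpErrBound (X i) (n i - 1) R (x i) := by
  have hB : 0 ≤ ∏ i, interpErrBound (X i) (n i - 1) R (x i) :=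
    Finset.prod_nonneg fun i _ => interpErrBound_nonneg _ _ hR _
  have hI : IntegrableOn (gridDiff n h f) (cube d R) :=
    (continuous_gridDiff n h hf).continuousOn.integrableOn_compact (isCompact_cube d R)
  have h1 : ‖∫ A in cube d R, dualKernel n X h f x A‖ ≤
      ∫ A in cube d R, gridDiff n h f A * ∏ i, interpErrBound (X i) (n i - 1) R (x i) := by
    refine norm_integral_le_of_norm_le (hI.mul_const _)
      ((ae_restrict_iff' (measurableSet_cube d R)).2 (Eventually.of_forall fun A hA => ?_))
    rw [mem_cube] at hA
    rw [dualKernel, norm_mul, Real.norm_of_nonneg (gridDiff_nonneg hh hbox A), norm_prod]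
    exact mul_le_mul_of_nonneg_left (Finset.prod_le_prod (fun _ _ => norm_nonneg _)
      fun i _ => abs_interpErr_le _ _ (hA i) _) (gridDiff_nonneg hh hbox A)
  rw [integral_mul_const] at h1
  exact h1.trans (mul_le_mul_of_nonneg_right hM hB)

/-! ### The limit of the truncated duality formula -/

section
variable {d : ℕ} {n : Fin d → ℕ} {m : Fin d → Measure ℝ} [∀ i, IsFiniteMeasure (m i)]
  {W : Fin d → ℝ → ℝ}

theorem integrable_prod_interpErrBound (hv : ∀ i, VanishingMoments (n i) (m i) (W i))
    {X : Fin d → Finset ℝ} (hX : ∀ i, (X i).card = n i) {R : ℝ} (hR : 0 ≤ R) :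
    Integrable (fun x : Fin d → ℝ => ∏ i, interpErrBound (X i) (n i - 1) R (x i)) (Measure.pi m) :=
  Integrable.fintype_prod fun i => (hv i).integrable_interpErrBound (hX i) hR

/-- After Fubini, the inner integral for fixed `A` factors over the coordinates, and vanishing
moments turn each interpolation error back into the truncated power. Boundedness of the cube
provides the integrable majorant. -/
theorem integral_setIntegral_dualKernel_nonneg (hn : ∀ i, 2 ≤ n i) {f : (Fin d → ℝ) → ℝ}
    (hf : Continuous f) (hbox : IsBoxConvex n f)
    (hv : ∀ i, VanishingMoments (n i) (m i) (W i))
    (hH : ∀ A : Fin d → ℝ, 0 ≤ ∏ i, ∫ x, truncPow (n i - 1) (A i) x * W i x ∂(m i))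
    {X : Fin d → Finset ℝ} (hX : ∀ i, (X i).card = n i) {h : ℝ} (hh : 0 < h) {R : ℝ} (hR : 0 ≤ R) :
    0 ≤ ∫ x, (∫ A in cube d R, dualKernel n X h f x A) * ∏ i, W i (x i) ∂(Measure.pi m) := by
  have hW := measurable_prod_weight fun i => (hv i).measurable
  have hI : IntegrableOn (gridDiff n h f) (cube d R) :=
    (continuous_gridDiff n h hf).continuousOn.integrableOn_compact (isCompact_cube d R)
  have hint : Integrable (fun p : (Fin d → ℝ) × (Fin d → ℝ) =>
      dualKernel n X h f p.1 p.2 * ∏ i, W i (p.1 i))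
      ((Measure.pi m).prod (volume.restrict (cube d R))) := by
    refine ((integrable_prod_interpErrBound hv hX hR).mul_prod hI).mono'
      ((continuous_dualKernel hn hf X h).measurable.mul
        (hW.comp measurable_fst)).aestronglyMeasurable ?_
    have hc : ∀ᵐ p ∂((Measure.pi m).prod (volume.restrict (cube d R))), p.2 ∈ cube d R :=
      Measure.quasiMeasurePreserving_snd.ae (ae_restrict_mem (measurableSet_cube d R))
    filter_upwards [hc] with p hp
    rw [mem_cube] at hp
    rw [norm_mul, Real.norm_eq_abs (∏ i, W i (p.1 i)), abs_prod_weight fun i => (hv i).abs_eq_one,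
      mul_one, dualKernel, norm_mul, Real.norm_of_nonneg (gridDiff_nonneg hh hbox _), mul_comm,
      norm_prod]
    exact mul_le_mul_of_nonneg_right (Finset.prod_le_prod (fun _ _ => norm_nonneg _)
      fun i _ => abs_interpErr_le _ _ (hp i) _) (gridDiff_nonneg hh hbox _)
  simp_rw [← integral_mul_const]
  rw [integral_integral_swap hint]
  refine integral_nonneg fun A => ?_
  have h1 : ∀ x : Fin d → ℝ, dualKernel n X h f x A * ∏ i, W i (x i) = gridDiff n h f A *
      ∏ i, (interpErr (X i) (truncPow (n i - 1) (A i)) (x i) * W i (x i)) := fun x => by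
    rw [dualKernel, Finset.prod_mul_distrib, mul_assoc]
  simp_rw [h1]
  rw [integral_const_mul, integral_fintype_prod_eq_prod (μ := m) (fun i t =>
    interpErr (X i) (truncPow (n i - 1) (A i)) t * W i t)]
  refine mul_nonneg (gridDiff_nonneg hh hbox A) ?_
  simp_rw [fun i => (hv i).integral_interpErr (hX i) (A i)]
  exact hH A

/-- A continuous box-convex function has a nonnegative integral against a product of weights with
vanishing moments, if the products of the integrals of truncated powers are nonnegative. -/
theorem integral_boxConvex_nonneg (hn : ∀ i, 2 ≤ n i) {f : (Fin d → ℝ) → ℝ}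
    (hf : Continuous f) (hbox : IsBoxConvex n f) (hfi : Integrable f (Measure.pi m))
    (hv : ∀ i, VanishingMoments (n i) (m i) (W i))
    (hH : ∀ A : Fin d → ℝ, 0 ≤ ∏ i, ∫ x, truncPow (n i - 1) (A i) x * W i x ∂(m i)) :
    0 ≤ ∫ x, f x * ∏ i, W i (x i) ∂(Measure.pi m) := by
  classical
  by_cases hm : ∃ i, m i = 0
  · obtain ⟨i, hi⟩ := hm
    have : Measure.pi m = 0 := by
      rw [← Measure.measure_univ_eq_zero, Measure.pi_univ]
      exact Finset.prod_eq_zero (Finset.mem_univ i) (by rw [hi]; simp)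
    simp [this]
  push Not at hm
  obtain ⟨X, hX, hTi, hTe⟩ := exists_nodes_listErr hv hm hfi (List.nodup_finRange d)
  rw [← hTe]
  set T := listErr X (List.finRange d) f with hT
  set w : (Fin d → ℝ) → ℝ := fun x => ∏ i, W i (x i) with hw
  have hwm : Measurable w := measurable_prod_weight fun i => (hv i).measurable
  have hw1 : ∀ x, |w x| = 1 := abs_prod_weight fun i => (hv i).abs_eq_one
  have hTm : Measurable T := (continuous_listErr X hf _).measurable
  set h : ℕ → ℝ := fun k => 1 / ((k : ℝ) + 1) with hhdef
  have hh : ∀ k, 0 < h k := fun k => by positivity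
  have h0 : Tendsto h atTop (𝓝 0) := tendsto_one_div_add_atTop_nhds_zero_nat
  set c : ℝ := ∏ i, (n i : ℝ)⁻¹ with hc
  have hc0 : 0 < c := Finset.prod_pos fun i _ => by have := hn i; positivity
  set g : ℕ → (Fin d → ℝ) → ℝ := fun k => listErr X (List.finRange d) (mollify n (h k) f) with hg
  have hglim : ∀ x, Tendsto (fun k => g k x) atTop (𝓝 (c * T x)) := fun x => by
    rw [hT, ← listErr_const_mul]
    exact tendsto_listErr X (fun x => (tendsto_mollify hn hf x).comp
      (tendsto_nhdsWithin_iff.2 ⟨h0, Eventually.of_forall hh⟩)) _ x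
  -- Measurability comes from the duality formula, which presents `g k` as a parameter integral of a
  -- continuous kernel.
  have hgm : ∀ k, Measurable (g k) := fun k => by
    have h1 := (continuous_dualKernel hn hf X (h k)).stronglyMeasurable.integral_prod_right'
      (ν := (volume : Measure (Fin d → ℝ)))
    have h2 : g k = fun x => ∫ A, dualKernel n X (h k) f x A :=
      funext fun x => (integral_gridDiff_mul_prod hn hX (hh k) hf x).symm
    rw [h2]
    exact h1.measurable
  obtain ⟨R₀, hR₀⟩ : ∃ R₀ : ℝ, ∀ i, ∀ a ∈ X i, |a| ≤ R₀ := by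
    obtain ⟨r, hr⟩ := (((Finset.univ.biUnion X).finite_toSet).image fun a => |a|).bddAbove
    exact ⟨r, fun i a ha => hr ⟨a, by simpa using ⟨i, ha⟩, rfl⟩⟩
  -- The limit `h → 0` with the cube fixed. Inside, the truncated integral is exactly `g k`;
  -- outside, only its modulus is controlled, whence the absolute value.
  have hJ : ∀ R : ℝ, 0 ≤ R → R₀ ≤ R → 0 ≤ ∫ x, (cube d R).piecewise (fun x => c * T x * w x)
      (fun x => |c * T x|) x ∂(Measure.pi m) := by
    intro R hR hRR
    obtain ⟨M, hM0, hM⟩ := bddAbove_setIntegral_gridDiff hn hf hbox R hh h0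
    set B : (Fin d → ℝ) → ℝ := fun x => M * ∏ i, interpErrBound (X i) (n i - 1) R (x i) with hB
    have hBi : Integrable B (Measure.pi m) := (integrable_prod_interpErrBound hv hX hR).const_mul M
    have hB0 : ∀ x, 0 ≤ B x := fun x => mul_nonneg hM0
      (Finset.prod_nonneg fun i _ => interpErrBound_nonneg _ _ hR _)
    set F : ℕ → (Fin d → ℝ) → ℝ := fun k x => ∫ A in cube d R, dualKernel n X (h k) f x A with hF
    have hFB : ∀ k x, |F k x| ≤ B x := fun k x =>
      abs_setIntegral_cube_dualKernel_le hf hbox (hh k) (hM k) hR X x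
    have hFg : ∀ k x, |F k x| ≤ |g k x| := fun k x =>
      abs_setIntegral_dualKernel_le hn hf hbox hX (hh k) _ x
    have hFe : ∀ k, ∀ x ∈ cube d R, F k x = g k x := fun k x hx =>
      setIntegral_cube_dualKernel hn hf hX (hh k) (fun i a ha => (hR₀ i a ha).trans hRR) hx
    have hFm : ∀ k, Measurable (F k) := fun k =>
      ((continuous_dualKernel hn hf X (h k)).stronglyMeasurable.integral_prod_right'
        (ν := (volume : Measure (Fin d → ℝ)).restrict (cube d R))).measurable
    have hFi : ∀ k, Integrable (F k) (Measure.pi m) := fun k =>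
      hBi.mono' (hFm k).aestronglyMeasurable (Eventually.of_forall (hFB k))
    -- `F k` need not converge outside the cube, so it is replaced by a majorant that does. The
    -- minimum with `B` keeps it dominated, since no integrable bound on `g k` is known there.
    set G : ℕ → (Fin d → ℝ) → ℝ := fun k => (cube d R).piecewise (fun x => g k x * w x)
      (fun x => min |g k x| (B x)) with hG
    have hG1 : ∀ k, ∀ x ∈ cube d R, G k x = g k x * w x := fun k x hx =>
      Set.piecewise_eq_of_mem _ _ _ hx
    have hG2 : ∀ k, ∀ x ∉ cube d R, G k x = min |g k x| (B x) := fun k x hx =>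
      Set.piecewise_eq_of_notMem _ _ _ hx
    have hBm : Measurable B := by
      refine measurable_const.mul (Finset.measurable_prod _ fun i _ =>
        Measurable.comp (g := interpErrBound (X i) (n i - 1) R) ?_ (measurable_pi_apply i))
      unfold interpErrBound
      have : ∀ P : Polynomial ℝ, Measurable fun x => P.eval x := fun P => P.continuous.measurable
      fun_prop
    have hGm : ∀ k, Measurable (G k) := fun k => Measurable.piecewise (measurableSet_cube d R)
      ((hgm k).mul hwm) (((hgm k).abs).min hBm)
    have hGB : ∀ k x, ‖G k x‖ ≤ B x := by
      intro k x
      by_cases hx : x ∈ cube d R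
      · rw [hG1 k x hx, norm_mul, Real.norm_eq_abs, Real.norm_eq_abs,
          hw1, mul_one, ← hFe k x hx]
        exact hFB k x
      · rw [hG2 k x hx, Real.norm_of_nonneg
          (le_min (abs_nonneg _) (hB0 x))]
        exact min_le_right _ _
    have hFG : ∀ k x, F k x * w x ≤ G k x := by
      intro k x
      by_cases hx : x ∈ cube d R
      · rw [hG1 k x hx, hFe k x hx]
      · rw [hG2 k x hx]
        refine (le_abs_self _).trans ?_
        rw [abs_mul, hw1, mul_one]
        exact le_min (hFg k x) (hFB k x)
    have hGi : ∀ k, Integrable (G k) (Measure.pi m) := fun k =>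
      hBi.mono' (hGm k).aestronglyMeasurable (Eventually.of_forall (hGB k))
    have hGnn : ∀ k, 0 ≤ ∫ x, G k x ∂(Measure.pi m) := fun k =>
      (integral_setIntegral_dualKernel_nonneg hn hf hbox hv hH hX (hh k) hR).trans
        (integral_mono (integrable_mul_weight (hFi k) hwm hw1) (hGi k) (hFG k))
    have hlim := tendsto_integral_of_dominated_convergence (μ := Measure.pi m)
      (f := (cube d R).piecewise (fun x => c * T x * w x) (fun x => min |c * T x| (B x))) B
      (fun k => (hGm k).aestronglyMeasurable) hBi (fun k => Eventually.of_forall (hGB k))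
      (Eventually.of_forall fun x => by
        by_cases hx : x ∈ cube d R
        · simp only [hG1 _ x hx, Set.piecewise_eq_of_mem _ _ _ hx]
          exact (hglim x).mul_const _
        · simp only [hG2 _ x hx, Set.piecewise_eq_of_notMem _ _ _ hx]
          exact (hglim x).abs.min tendsto_const_nhds)
    refine (ge_of_tendsto' hlim hGnn).trans ?_
    have hcT : Integrable (fun x => c * T x) (Measure.pi m) := hTi.const_mul c
    have hcTw := integrable_mul_weight hcT hwm hw1
    refine integral_mono (μ := Measure.pi m)
      (Integrable.piecewise (measurableSet_cube d R) hcTw.integrableOn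
        (Integrable.integrableOn ?_))
      (Integrable.piecewise (measurableSet_cube d R) hcTw.integrableOn hcT.abs.integrableOn)
      fun x => ?_
    · exact hcT.abs.inf hBi
    · by_cases hx : x ∈ cube d R
      · simp only [Set.piecewise_eq_of_mem _ _ _ hx]; exact le_rfl
      · simp only [Set.piecewise_eq_of_notMem _ _ _ hx]; exact min_le_left _ _
  have hcT : Integrable (fun x => c * T x) (Measure.pi m) := hTi.const_mul c
  -- Now the cube grows: each point is eventually inside, and integrability of `T` supplies the
  -- majorant.
  have hlim := tendsto_integral_of_dominated_convergence (μ := Measure.pi m)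
    (F := fun N : ℕ => (cube d (N : ℝ)).piecewise (fun x => c * T x * w x) (fun x => |c * T x|))
    (f := fun x => c * T x * w x) (fun x => |c * T x|)
    (fun N => (Measurable.piecewise (measurableSet_cube d N) ((measurable_const.mul hTm).mul hwm)
      (measurable_const.mul hTm).abs).aestronglyMeasurable) hcT.abs
    (fun N => Eventually.of_forall fun x => by
      by_cases hx : x ∈ cube d (N : ℝ)
      · rw [Set.piecewise_eq_of_mem _ _ _ hx, norm_mul, Real.norm_eq_abs (w x), hw1, mul_one,
          Real.norm_eq_abs]
      · rw [Set.piecewise_eq_of_notMem _ _ _ hx, Real.norm_eq_abs, abs_abs])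
    (Eventually.of_forall fun x => by
      refine tendsto_const_nhds.congr' ?_
      obtain ⟨r, hr⟩ := (Set.finite_range fun i => |x i|).bddAbove
      filter_upwards [eventually_ge_atTop ⌈r⌉₊] with N hN
      rw [Set.piecewise_eq_of_mem]
      exact mem_cube.2 fun i => (hr ⟨i, rfl⟩).trans ((Nat.le_ceil r).trans (by exact_mod_cast hN)))
  have hfin : 0 ≤ ∫ x, c * T x * w x ∂(Measure.pi m) := by
    refine ge_of_tendsto hlim ?_
    filter_upwards [eventually_ge_atTop ⌈R₀⌉₊] with N hN
    exact hJ N N.cast_nonneg ((Nat.le_ceil R₀).trans (by exact_mod_cast hN))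
  simp_rw [mul_assoc] at hfin
  rw [integral_const_mul] at hfin
  exact nonneg_of_mul_nonneg_right hfin hc0
end

/-! ### Signed measures as weighted measures -/

theorem integral_signedMeasure_eq_jordan {α : Type*} [MeasurableSpace α] (γ : SignedMeasure α)
    {f : α → ℝ} (hf : γ.Integrable f) :
    ∫ᵛ x, f x ∂•γ = ∫ x, f x ∂γ.toJordanDecomposition.posPart -
      ∫ x, f x ∂γ.toJordanDecomposition.negPart := by
  have hf' : Integrable f (γ.toJordanDecomposition.posPart + γ.toJordanDecomposition.negPart) := by
    rw [VectorMeasure.Integrable, ← SignedMeasure.totalVariation_eq_variation] at hf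
    exact hf
  -- Multiplication of reals is commutative; the flipped pairing is the form in which integrals
  -- against a positive measure are rewritten.
  have hl : ContinuousLinearMap.lsmul ℝ ℝ = (ContinuousLinearMap.lsmul ℝ ℝ : ℝ →L[ℝ] ℝ →L[ℝ] ℝ).flip := by
    ext; simp
  have h1 : ∫ᵛ x, f x ∂•γ = ∫ᵛ x, f x ∂•(γ.toJordanDecomposition.posPart.toSignedMeasure -
      γ.toJordanDecomposition.negPart.toSignedMeasure) := by
    congr 1
    exact γ.toSignedMeasure_toJordanDecomposition.symm
  rw [h1, VectorMeasure.integral_sub_vectorMeasure, hl, VectorMeasure.integral_toSignedMeasure,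
    VectorMeasure.integral_toSignedMeasure]
  · rw [VectorMeasure.Integrable, Measure.variation_toSignedMeasure]
    exact hf'.left_of_add_measure
  · rw [VectorMeasure.Integrable, Measure.variation_toSignedMeasure]
    exact hf'.right_of_add_measure

/-- A signed measure has a density with values `±1` with respect to its variation. -/
theorem exists_signDensity {α : Type*} [MeasurableSpace α] (γ : SignedMeasure α) :
    ∃ W : α → ℝ, Measurable W ∧ (∀ x, |W x| = 1) ∧
      ∀ f : α → ℝ, γ.Integrable f → ∫ᵛ x, f x ∂•γ = ∫ x, f x * W x ∂γ.variation := by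
  classical
  obtain ⟨s, hs, hpos, hneg⟩ := γ.toJordanDecomposition.mutuallySingular
  set W : α → ℝ := fun x => if x ∈ s then -1 else 1 with hW
  have hWm : Measurable W := Measurable.ite hs measurable_const measurable_const
  have hW1 : ∀ x, |W x| = 1 := fun x => by simp only [hW]; split_ifs <;> simp
  refine ⟨W, hWm, hW1, fun f hf => ?_⟩
  rw [integral_signedMeasure_eq_jordan γ hf]
  rw [VectorMeasure.Integrable, ← SignedMeasure.totalVariation_eq_variation,
    SignedMeasure.totalVariation] at hf
  have hfW := integrable_mul_weight hf hWm hW1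
  rw [← SignedMeasure.totalVariation_eq_variation, SignedMeasure.totalVariation,
    integral_add_measure hfW.left_of_add_measure hfW.right_of_add_measure, sub_eq_add_neg,
    ← integral_neg]
  congr 1
  · refine integral_congr_ae ?_
    filter_upwards [compl_mem_ae_iff.2 hpos] with x hx
    simp only [hW, if_neg hx, mul_one]
  · refine integral_congr_ae ?_
    filter_upwards [mem_ae_iff.2 hneg] with x hx
    simp only [hW, if_pos hx, mul_neg, mul_one]

/-- A density of a signed measure with respect to its variation, with values `±1`. -/
def signDensity {α : Type*} [MeasurableSpace α] (γ : SignedMeasure α) : α → ℝ :=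
  (exists_signDensity γ).choose

section
variable {α : Type*} [MeasurableSpace α] (γ : SignedMeasure α)

theorem measurable_signDensity : Measurable (signDensity γ) :=
  (exists_signDensity γ).choose_spec.1

theorem abs_signDensity (x : α) : |signDensity γ x| = 1 :=
  (exists_signDensity γ).choose_spec.2.1 x

theorem integral_eq_signDensity {f : α → ℝ} (hf : γ.Integrable f) :
    ∫ᵛ x, f x ∂•γ = ∫ x, f x * signDensity γ x ∂γ.variation :=
  (exists_signDensity γ).choose_spec.2.2 f hf

theorem integrable_signDensity : Integrable (signDensity γ) γ.variation := by
  simpa using integrable_mul_weight (integrable_const (1 : ℝ)) (measurable_signDensity γ)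
    (abs_signDensity γ)

theorem setIntegral_signDensity {s : Set α} (hs : MeasurableSet s) :
    ∫ x in s, signDensity γ x ∂γ.variation = γ s := by
  have hi : γ.Integrable (s.indicator fun _ => (1 : ℝ)) := (integrable_const 1).indicator hs
  have h1 := integral_eq_signDensity γ hi
  rw [integral_signedMeasure_eq_jordan γ hi, integral_indicator hs, integral_indicator hs] at h1
  have h2 := γ.apply_eq_posPart_real_sub_negPart_real hs
  simp only [integral_const, smul_eq_mul, mul_one, measureReal_restrict_apply_univ] at h1
  rw [h2, h1, ← integral_indicator hs]
  congr 1
  funext x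
  by_cases hx : x ∈ s <;> simp [hx]

theorem withDensity_signDensity : γ.variation.withDensityᵥ (signDensity γ) = γ := by
  ext s hs
  rw [withDensityᵥ_apply (integrable_signDensity γ) hs, setIntegral_signDensity γ hs]

end

theorem variation_withDensity_of_abs_eq_one {α : Type*} [MeasurableSpace α] {m : Measure α}
    [IsFiniteMeasure m] {w : α → ℝ} (hw : Measurable w) (hw1 : ∀ x, |w x| = 1) :
    (m.withDensityᵥ w).variation = m := by
  have hi : Integrable w m := by simpa using integrable_mul_weight (integrable_const (1 : ℝ)) hw hw1
  have h1 : (fun x => ‖w x‖ₑ) = 1 := by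
    funext x
    rw [← ofReal_norm, Real.norm_eq_abs, hw1]; simp
  rw [Measure.variation_withDensityᵥ hi, h1, withDensity_one]

/-- The variation is `m`, so `w` and the chosen sign density are two densities of one signed measure
and agree almost everywhere. -/
theorem integral_withDensity_of_abs_eq_one {α : Type*} [MeasurableSpace α] {m : Measure α}
    [IsFiniteMeasure m] {w : α → ℝ} (hw : Measurable w) (hw1 : ∀ x, |w x| = 1) {f : α → ℝ}
    (hf : Integrable f m) : ∫ᵛ x, f x ∂•(m.withDensityᵥ w) = ∫ x, f x * w x ∂m := by
  have hi : Integrable w m := by simpa using integrable_mul_weight (integrable_const (1 : ℝ)) hw hw1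
  have hv := variation_withDensity_of_abs_eq_one hw hw1 (m := m)
  have hI := integrable_signDensity (m.withDensityᵥ w)
  have hW := withDensity_signDensity (m.withDensityᵥ w)
  have hint := integral_eq_signDensity (m.withDensityᵥ w) (f := f) (by
    rw [VectorMeasure.Integrable, hv]; exact hf)
  rw [hv] at hI hW hint
  rw [hint]
  refine integral_congr_ae ?_
  filter_upwards [hI.ae_eq_of_withDensityᵥ_eq hi hW] with x hx
  rw [hx]

/-! ### Products -/

/-- Both sides agree on measurable boxes, a generating π-system. Integrals against the signed
product thereby become ordinary integrals with a product weight of modulus one. -/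
theorem signedPi_eq_withDensity {d : ℕ} (τ : Fin d → SignedMeasure ℝ) :
    signedPi τ = (Measure.pi fun i => (τ i).variation).withDensityᵥ
      fun x => ∏ i, signDensity (τ i) (x i) := by
  have hi : Integrable (fun x : Fin d → ℝ => ∏ i, signDensity (τ i) (x i))
      (Measure.pi fun i => (τ i).variation) :=
    Integrable.fintype_prod fun i => integrable_signDensity (τ i)
  have key : ∀ s : Fin d → Set ℝ, (∀ i, MeasurableSet (s i)) →
      signedPi τ (Set.univ.pi s) = (Measure.pi fun i => (τ i).variation).withDensityᵥ
        (fun x => ∏ i, signDensity (τ i) (x i)) (Set.univ.pi s) := by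
    intro s hs
    rw [signedPi_apply τ s hs, withDensityᵥ_apply hi (MeasurableSet.univ_pi hs),
      Measure.restrict_pi_pi, integral_fintype_prod_eq_prod]
    exact Finset.prod_congr rfl fun i _ => (setIntegral_signDensity (τ i) (hs i)).symm
  refine VectorMeasure.ext_of_generateFrom _ ?_ generateFrom_pi.symm isPiSystem_pi ?_
  · rintro _ ⟨s, hs, rfl⟩
    exact key s fun i => hs i (Set.mem_univ i)
  · rw [← Set.pi_univ Set.univ]
    exact key _ fun _ => MeasurableSet.univ

theorem variation_signedPi {d : ℕ} (τ : Fin d → SignedMeasure ℝ) :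
    (signedPi τ).variation = Measure.pi fun i => (τ i).variation := by
  rw [signedPi_eq_withDensity]
  exact variation_withDensity_of_abs_eq_one
    (measurable_prod_weight fun i => measurable_signDensity (τ i))
    (abs_prod_weight fun i => abs_signDensity (τ i))

theorem integral_signedPi {d : ℕ} (τ : Fin d → SignedMeasure ℝ) {f : (Fin d → ℝ) → ℝ}
    (hf : Integrable f (Measure.pi fun i => (τ i).variation)) :
    ∫ᵛ x, f x ∂•(signedPi τ) = ∫ x, f x * ∏ i, signDensity (τ i) (x i)
      ∂(Measure.pi fun i => (τ i).variation) := by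
  rw [signedPi_eq_withDensity]
  exact integral_withDensity_of_abs_eq_one
    (measurable_prod_weight fun i => measurable_signDensity (τ i))
    (abs_prod_weight fun i => abs_signDensity (τ i)) hf

theorem signedProd_eq_withDensity {X Y : Type*} [MeasurableSpace X] [MeasurableSpace Y]
    (γ₁ : SignedMeasure X) (γ₂ : SignedMeasure Y) :
    signedProd γ₁ γ₂ = (γ₁.variation.prod γ₂.variation).withDensityᵥ
      fun p => signDensity γ₁ p.1 * signDensity γ₂ p.2 := by
  refine VectorMeasure.prod_eq_of_forall_apply_prod fun s t hs ht => ?_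
  rw [withDensityᵥ_apply ((integrable_signDensity γ₁).mul_prod (integrable_signDensity γ₂))
    (hs.prod ht), ← Measure.prod_restrict, integral_prod_mul, setIntegral_signDensity γ₁ hs,
    setIntegral_signDensity γ₂ ht]
  rfl

theorem measurable_mul_signDensity {X Y : Type*} [MeasurableSpace X] [MeasurableSpace Y]
    (γ₁ : SignedMeasure X) (γ₂ : SignedMeasure Y) :
    Measurable fun p : X × Y => signDensity γ₁ p.1 * signDensity γ₂ p.2 :=
  ((measurable_signDensity γ₁).comp measurable_fst).mul
    ((measurable_signDensity γ₂).comp measurable_snd)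

theorem abs_mul_signDensity {X Y : Type*} [MeasurableSpace X] [MeasurableSpace Y]
    (γ₁ : SignedMeasure X) (γ₂ : SignedMeasure Y) (p : X × Y) :
    |signDensity γ₁ p.1 * signDensity γ₂ p.2| = 1 := by
  rw [abs_mul, abs_signDensity, abs_signDensity, one_mul]

/-! ### Convolutions -/

/-- Only an inequality, since positive and negative mass may cancel under addition. -/
theorem variation_signedConv_le (γ₁ γ₂ : SignedMeasure ℝ) :
    (signedConv γ₁ γ₂).variation ≤
      (γ₁.variation.prod γ₂.variation).map fun p => p.1 + p.2 := by
  refine VectorMeasure.variation_map_le.trans (le_of_eq ?_)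
  rw [signedProd_eq_withDensity, variation_withDensity_of_abs_eq_one
    (measurable_mul_signDensity γ₁ γ₂) (abs_mul_signDensity γ₁ γ₂)]

theorem integral_signedConv (γ₁ γ₂ : SignedMeasure ℝ) {f : ℝ → ℝ} (hfm : Measurable f)
    (hf : Integrable (fun p : ℝ × ℝ => f (p.1 + p.2)) (γ₁.variation.prod γ₂.variation)) :
    ∫ x, f x * signDensity (signedConv γ₁ γ₂) x ∂(signedConv γ₁ γ₂).variation =
      ∫ p : ℝ × ℝ, f (p.1 + p.2) * (signDensity γ₁ p.1 * signDensity γ₂ p.2)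
        ∂(γ₁.variation.prod γ₂.variation) := by
  have hwm := measurable_mul_signDensity γ₁ γ₂
  have hw1 := abs_mul_signDensity γ₁ γ₂
  have hadd : Measurable fun p : ℝ × ℝ => p.1 + p.2 := measurable_fst.add measurable_snd
  have hfc : (signedConv γ₁ γ₂).Integrable f :=
    ((integrable_map_measure hfm.aestronglyMeasurable hadd.aemeasurable).2 hf).mono_measure
      (variation_signedConv_le γ₁ γ₂)
  have hfp : (signedProd γ₁ γ₂).Integrable (f ∘ fun p : ℝ × ℝ => p.1 + p.2) := by
    rw [VectorMeasure.Integrable, signedProd_eq_withDensity,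
      variation_withDensity_of_abs_eq_one hwm hw1]
    exact hf
  rw [← integral_eq_signDensity _ hfc, signedConv,
    VectorMeasure.integral_map hadd hfm.aestronglyMeasurable hfp, signedProd_eq_withDensity,
    integral_withDensity_of_abs_eq_one hwm hw1 hf]

/-- Needed because powers of measures start from `δ₀`, powers of functions from the first power. -/
theorem signedConv_dirac_zero (σ : SignedMeasure ℝ) :
    signedConv (VectorMeasure.dirac 0 1) σ = σ := by
  have hm : Measurable fun y : ℝ => ((0 : ℝ), y) := measurable_const.prodMk measurable_id
  have hadd : Measurable fun p : ℝ × ℝ => p.1 + p.2 := measurable_fst.add measurable_snd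
  have h1 : signedProd (VectorMeasure.dirac (0 : ℝ) (1 : ℝ)) σ = σ.map fun y : ℝ => ((0 : ℝ), y) := by
    refine VectorMeasure.prod_eq_of_forall_apply_prod fun s t hs ht => ?_
    rw [VectorMeasure.map_apply _ hm (hs.prod ht)]
    by_cases h0 : (0 : ℝ) ∈ s
    · rw [VectorMeasure.dirac_apply_of_mem hs h0, Set.mk_preimage_prod_right h0]; simp
    · rw [VectorMeasure.dirac_apply_of_notMem h0, Set.mk_preimage_prod_right_eq_empty h0]; simp
  ext s hs
  rw [signedConv, h1, VectorMeasure.map_apply _ hadd hs, VectorMeasure.map_apply _ hm (hadd hs)]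
  congr 1
  ext y
  simp

/-! ### Moments of convolution powers -/

section
variable {N : ℕ}

theorem integrable_abs_pow_add {m₁ m₂ : Measure ℝ} [IsFiniteMeasure m₁] [IsFiniteMeasure m₂]
    (h₁ : Integrable (fun x : ℝ => |x| ^ N) m₁) (h₂ : Integrable (fun x : ℝ => |x| ^ N) m₂) :
    Integrable (fun x : ℝ => |x| ^ N) ((m₁.prod m₂).map fun p => p.1 + p.2) := by
  rw [integrable_map_measure (by fun_prop) (by fun_prop)]
  refine (((h₁.comp_fst m₂).add (h₂.comp_snd m₁)).const_mul (2 ^ (N - 1))).mono' (by fun_prop)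
    (Eventually.of_forall fun p => ?_)
  simp only [Function.comp, Pi.add_apply]
  rw [Real.norm_of_nonneg (by positivity)]
  exact (pow_le_pow_left₀ (abs_nonneg _) (abs_add_le _ _) _).trans
    (add_pow_le (abs_nonneg _) (abs_nonneg _) N)

theorem integrable_pow_signedConvPow {σ : SignedMeasure ℝ}
    (hσ : Integrable (fun x : ℝ => |x| ^ N) σ.variation) (k : ℕ) :
    Integrable (fun x : ℝ => |x| ^ N) (signedConvPow σ k).variation := by
  induction k with
  | zero =>
    rw [signedConvPow, VectorMeasure.variation_dirac]
    exact (integrable_dirac (by simp)).smul_measure (by simp)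
  | succ k ih => exact (integrable_abs_pow_add ih hσ).mono_measure (variation_signedConv_le _ _)

theorem integral_pow_signedConvPow {σ : SignedMeasure ℝ}
    (hσ : Integrable (fun x : ℝ => |x| ^ N) σ.variation) (h0 : σ Set.univ = 0) {k j : ℕ} (hj : j < k)
    (hN : j ≤ N) :
    ∫ x, x ^ j * signDensity (signedConvPow σ k) x ∂(signedConvPow σ k).variation = 0 := by
  induction k generalizing j with
  | zero => omega
  | succ k ih =>
    have hpow : ∀ (m : Measure ℝ) [IsFiniteMeasure m], Integrable (fun x : ℝ => |x| ^ N) m →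
        ∀ i ≤ N, Integrable (fun x : ℝ => x ^ i) m := fun m _ hm i hi => by
      refine (integrable_abs_pow_of_le hi hm).mono' (by fun_prop) (Eventually.of_forall fun x => ?_)
      rw [norm_pow, Real.norm_eq_abs]
    have hτ := integrable_pow_signedConvPow hσ k
    rw [signedConvPow, integral_signedConv _ _ (f := fun x => x ^ j) (by fun_prop)
      ((integrable_map_measure (f := fun p : ℝ × ℝ => p.1 + p.2) (g := fun x : ℝ => x ^ j)
        (by fun_prop) (by fun_prop)).1 (hpow _ (integrable_abs_pow_add hτ hσ) j hN))]
    have h1 : ∀ p : ℝ × ℝ, (p.1 + p.2) ^ j * (signDensity (signedConvPow σ k) p.1 * signDensity σ p.2)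
        = ∑ i ∈ Finset.range (j + 1), (j.choose i : ℝ) *
          ((p.1 ^ i * signDensity (signedConvPow σ k) p.1) * (p.2 ^ (j - i) * signDensity σ p.2)) := by
      intro p
      rw [add_pow, Finset.sum_mul]
      exact Finset.sum_congr rfl fun i _ => by ring
    simp_rw [h1]
    rw [integral_finsetSum]
    · refine Finset.sum_eq_zero fun i hi => ?_
      have hi' := Finset.mem_range.1 hi
      rw [integral_const_mul, integral_prod_mul (fun x => x ^ i * signDensity (signedConvPow σ k) x)
        fun y => y ^ (j - i) * signDensity σ y]
      -- In the binomial expansion of `(x + y) ^ j` with `j ≤ k`, either the first factor is a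
      -- vanishing moment of the `k`-th power, or `i = j = k` and the second factor is the total
      -- mass of `σ`, which is zero.
      by_cases hik : i < k
      · rw [ih hik (by omega), zero_mul, mul_zero]
      · have : j - i = 0 := by omega
        have h2 := setIntegral_signDensity σ MeasurableSet.univ
        rw [h0, Measure.restrict_univ] at h2
        simp only [this, pow_zero, one_mul, h2, mul_zero]
    · intro i hi
      have hi' := Finset.mem_range.1 hi
      refine Integrable.const_mul (Integrable.mul_prod
        (f := fun x : ℝ => x ^ i * signDensity (signedConvPow σ k) x)
        (g := fun y : ℝ => y ^ (j - i) * signDensity σ y) ?_ ?_) _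
      · exact integrable_mul_weight (hpow _ hτ i (by omega)) (measurable_signDensity _)
          (abs_signDensity _)
      · exact integrable_mul_weight (hpow _ hσ (j - i) (by omega)) (measurable_signDensity _)
          (abs_signDensity _)

theorem vanishingMoments_signedConvPow {n : ℕ} {σ : SignedMeasure ℝ}
    (hσ : Integrable (fun x : ℝ => |x| ^ (n - 1)) σ.variation) (h0 : σ Set.univ = 0) :
    VanishingMoments n (signedConvPow σ n).variation (signDensity (signedConvPow σ n)) where
  measurable := measurable_signDensity _
  abs_eq_one := abs_signDensity _
  integrable := integrable_pow_signedConvPow hσ n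
  integral_eq_zero P hP := by
    rcases eq_or_ne P 0 with rfl | hP0
    · simp
    have hd := (Polynomial.natDegree_lt_iff_degree_lt hP0).2 hP
    simp_rw [Polynomial.eval_eq_sum_range, Finset.sum_mul, mul_assoc]
    rw [integral_finsetSum]
    · refine Finset.sum_eq_zero fun j hj => ?_
      have := Finset.mem_range.1 hj
      rw [integral_const_mul, integral_pow_signedConvPow hσ h0 (by omega) (by omega), mul_zero]
    · intro j hj
      have := Finset.mem_range.1 hj
      refine (integrable_mul_weight (g := fun x : ℝ => x ^ j) ?_ (measurable_signDensity _)
        (abs_signDensity _)).const_mul _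
      refine (integrable_abs_pow_of_le (k := j) (by omega) (integrable_pow_signedConvPow hσ n)).mono'
        (by fun_prop) (Eventually.of_forall fun x => ?_)
      rw [norm_pow, Real.norm_eq_abs]

end

/-! ### Convolution powers of tails -/

/-- The integrand is `(x - t) ^ k` on `[A - y, x]` and zero elsewhere. This is the step from one
convolution power of the tail to the next. -/
theorem integral_truncPow_mul_step (k : ℕ) (A x y : ℝ) :
    Integrable (fun t => truncPow k t x * truncPow 0 (A - t) y) ∧
    ∫ t, truncPow k t x * truncPow 0 (A - t) y = truncPow (k + 1) A (x + y) / (k + 1 : ℕ) := by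
  have h1 : (fun t => truncPow k t x * truncPow 0 (A - t) y) =
      (Set.Icc (A - y) x).indicator fun t => (x - t) ^ k := by
    funext t
    by_cases ht : t ∈ Set.Icc (A - y) x
    · rw [Set.indicator_of_mem ht, truncPow_of_le ht.2, truncPow_of_le (by linarith [ht.1]),
        pow_zero, mul_one]
    · rw [Set.indicator_of_notMem ht]
      rw [Set.mem_Icc, not_and_or, not_le, not_le] at ht
      rcases ht with h | h
      · rw [truncPow_of_lt (k := 0) (by linarith), mul_zero]
      · rw [truncPow_of_lt h, zero_mul]
  have hc : Continuous fun t : ℝ => (x - t) ^ k := by fun_prop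
  refine ⟨?_, ?_⟩
  · rw [h1, integrable_indicator_iff measurableSet_Icc]
    exact hc.continuousOn.integrableOn_compact isCompact_Icc
  · rw [h1, integral_indicator measurableSet_Icc, integral_Icc_eq_integral_Ioc]
    by_cases hA : A - y ≤ x
    · rw [← intervalIntegral.integral_of_le hA,
        intervalIntegral.integral_comp_sub_left (fun t => t ^ k), integral_pow,
        truncPow_of_le (by linarith)]
      simp only [sub_self, ne_eq, Nat.succ_ne_zero, not_false_eq_true, zero_pow, sub_zero]
      push_cast
      congr 2
      ring
    · rw [Set.Ioc_eq_empty (by intro h; exact hA h.le), truncPow_of_lt (by linarith)]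
      simp

theorem integral_truncPow_zero (σ : SignedMeasure ℝ) (A : ℝ) :
    ∫ x, truncPow 0 A x * signDensity σ x ∂σ.variation = σ (Set.Ici A) := by
  rw [← setIntegral_signDensity σ measurableSet_Ici, ← integral_indicator measurableSet_Ici]
  congr 1
  funext x
  by_cases hx : A ≤ x
  · rw [Set.indicator_of_mem (Set.mem_Ici.2 hx), truncPow_of_le hx, pow_zero, one_mul]
  · rw [Set.indicator_of_notMem (by simpa using hx), truncPow_of_lt (not_le.1 hx), zero_mul]

/-- Writing a truncated power of a sum as a convolution in the knot, Fubini separates the variables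
into the previous power and one more tail. Each step contributes a factor `k + 1`, hence the
factorial. -/
theorem integral_truncPow_signedConvPow {N : ℕ} {σ : SignedMeasure ℝ}
    (hσ : Integrable (fun x : ℝ => |x| ^ N) σ.variation) {k : ℕ} (hk : k ≤ N) (A : ℝ) :
    ∫ x, truncPow k A x * signDensity (signedConvPow σ (k + 1)) x
        ∂(signedConvPow σ (k + 1)).variation =
      k.factorial * funConvPow (fun A => σ (Set.Ici A)) (k + 1) A := by
  induction k generalizing A with
  | zero =>
    have h1 : signedConvPow σ (0 + 1) = σ := signedConv_dirac_zero σ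
    rw [h1, integral_truncPow_zero]
    simp [funConvPow]
  | succ k ih =>
    set τ := signedConvPow σ (k + 1) with hτdef
    have hτ : Integrable (fun x : ℝ => |x| ^ N) τ.variation := integrable_pow_signedConvPow hσ _
    have hmeas : ∀ k A, Measurable (truncPow k A) := fun k A =>
      (measurable_truncPow k).comp (by fun_prop : Measurable fun x : ℝ => (A, x))
    have hint : Integrable (fun p : ℝ × ℝ => truncPow (k + 1) A (p.1 + p.2))
        (τ.variation.prod σ.variation) :=
      (integrable_map_measure (f := fun p : ℝ × ℝ => p.1 + p.2) (g := truncPow (k + 1) A)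
        (hmeas _ _).aestronglyMeasurable (by fun_prop)).1
        (integrable_truncPow_of_le hk (integrable_abs_pow_add hτ hσ) A)
    have hL : ∫ x, truncPow (k + 1) A x * signDensity (signedConvPow σ (k + 1 + 1)) x
        ∂(signedConvPow σ (k + 1 + 1)).variation = ∫ p : ℝ × ℝ, truncPow (k + 1) A (p.1 + p.2) *
          (signDensity τ p.1 * signDensity σ p.2) ∂(τ.variation.prod σ.variation) :=
      integral_signedConv τ σ (hmeas _ _) hint
    have hwm := measurable_mul_signDensity τ σ
    have hw1 := abs_mul_signDensity τ σ
    set Φ : ℝ × ℝ → ℝ → ℝ := fun p t => truncPow k t p.1 * truncPow 0 (A - t) p.2 with hΦ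
    have hΦm : Measurable (Function.uncurry Φ) :=
      ((measurable_truncPow k).comp (by fun_prop : Measurable fun q : (ℝ × ℝ) × ℝ => (q.2, q.1.1))).mul
      ((measurable_truncPow 0).comp
        (by fun_prop : Measurable fun q : (ℝ × ℝ) × ℝ => (A - q.2, q.1.2)))
    have hΨ : Integrable (Function.uncurry fun (p : ℝ × ℝ) (t : ℝ) =>
        Φ p t * (signDensity τ p.1 * signDensity σ p.2))
        ((τ.variation.prod σ.variation).prod volume) := by
      have hm : Measurable (Function.uncurry fun (p : ℝ × ℝ) (t : ℝ) =>
        Φ p t * (signDensity τ p.1 * signDensity σ p.2)) := hΦm.mul (hwm.comp measurable_fst)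
      -- The weights have modulus one and `Φ` is nonnegative, so the inner integral of the modulus
      -- is again a truncated power, integrable by the moment condition.
      rw [integrable_prod_iff hm.aestronglyMeasurable]
      refine ⟨Eventually.of_forall fun p =>
        (integral_truncPow_mul_step k A p.1 p.2).1.mul_const
          (signDensity τ p.1 * signDensity σ p.2), ?_⟩
      refine (hint.div_const ((k + 1 : ℕ) : ℝ)).congr (Eventually.of_forall fun p => ?_)
      simp only [Function.uncurry]
      rw [← (integral_truncPow_mul_step k A p.1 p.2).2]
      refine integral_congr_ae (Eventually.of_forall fun t => ?_)
      simp only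
      rw [norm_mul, Real.norm_eq_abs (signDensity τ p.1 * signDensity σ p.2), hw1 p, mul_one,
        Real.norm_of_nonneg
        (mul_nonneg (truncPow_nonneg _ _ _) (truncPow_nonneg _ _ _))]
    have hswap := integral_integral_swap hΨ
    have hLeft : ∀ p : ℝ × ℝ, ∫ t, Φ p t * (signDensity τ p.1 * signDensity σ p.2) =
        ((k + 1 : ℕ) : ℝ)⁻¹ * (truncPow (k + 1) A (p.1 + p.2) *
          (signDensity τ p.1 * signDensity σ p.2)) := fun p => by
      rw [integral_mul_const, (integral_truncPow_mul_step k A p.1 p.2).2]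
      ring
    have hRight : ∀ t, ∫ p : ℝ × ℝ, Φ p t * (signDensity τ p.1 * signDensity σ p.2)
        ∂(τ.variation.prod σ.variation) = k.factorial *
          (funConvPow (fun A => σ (Set.Ici A)) (k + 1) t * σ (Set.Ici (A - t))) := fun t => by
      have h1 : ∀ p : ℝ × ℝ, Φ p t * (signDensity τ p.1 * signDensity σ p.2) =
          (truncPow k t p.1 * signDensity τ p.1) *
            (truncPow 0 (A - t) p.2 * signDensity σ p.2) := fun p => by rw [hΦ]; ring
      simp_rw [h1]
      rw [integral_prod_mul (fun x => truncPow k t x * signDensity τ x)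
        fun y => truncPow 0 (A - t) y * signDensity σ y, ih (by omega), integral_truncPow_zero]
      ring
    simp_rw [hLeft, hRight] at hswap
    rw [integral_const_mul, integral_const_mul] at hswap
    have hconv : funConvPow (fun A => σ (Set.Ici A)) (k + 1 + 1) A =
        ∫ t, funConvPow (fun A => σ (Set.Ici A)) (k + 1) t * σ (Set.Ici (A - t)) := rfl
    rw [hL, hconv, Nat.factorial_succ, Nat.cast_mul, mul_assoc, ← hswap]
    have : ((k + 1 : ℕ) : ℝ) ≠ 0 := by positivity
    field_simp

/-! ### The test functions and the equivalence -/

theorem isBoxConvex_prod_truncPow {d : ℕ} {n : Fin d → ℕ} (hn : ∀ i, n i ≠ 0) (A : Fin d → ℝ) :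
    IsBoxConvex n fun x => ∏ i, truncPow (n i - 1) (A i) (x i) := by
  intro x hx
  rw [multiDividedDiff_eq_sum n x hx]
  simp_rw [← Finset.prod_mul_distrib]
  -- The multiple divided difference of a product of one-variable functions is the product of their
  -- divided differences.
  have h1 := Finset.prod_univ_sum (fun i => (Finset.univ : Finset (Fin (n i + 1))))
    fun i j => Lagrange.nodalWeight Finset.univ (x i) j * truncPow (n i - 1) (A i) (x i j)
  rw [Fintype.piFinset_univ] at h1
  rw [← h1]
  refine Finset.prod_nonneg fun i _ => ?_
  rw [← finDD_image (hx i)]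
  refine finDD_truncPow_nonneg _ ?_
  rw [Finset.card_image_of_injective _ (hx i), Finset.card_univ, Fintype.card_fin]
  have := hn i
  omega

end

theorem mainTheorem12 {d : ℕ} (n : Fin d → ℕ) (hn : ∀ i, 2 ≤ n i)
    (μ ν : Fin d → Measure ℝ)
    [∀ i, IsProbabilityMeasure (μ i)] [∀ i, IsProbabilityMeasure (ν i)]
    (hμ : ∀ i, Integrable (fun x : ℝ => |x| ^ (n i - 1)) (μ i))
    (hν : ∀ i, Integrable (fun x : ℝ => |x| ^ (n i - 1)) (ν i)) :
    BoxConvexLE n 0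
        (signedPi fun i =>
          signedConvPow ((ν i).toSignedMeasure - (μ i).toSignedMeasure) (n i)) ↔
      ∀ A : Fin d → ℝ,
        0 ≤ ∏ i, funConvPow (tailFun (ν i) - tailFun (μ i)) (n i) (A i) := by
  set σ : Fin d → SignedMeasure ℝ := fun i => (ν i).toSignedMeasure - (μ i).toSignedMeasure with hσ
  set τ : Fin d → SignedMeasure ℝ := fun i => signedConvPow (σ i) (n i) with hτ
  have hmom : ∀ i, Integrable (fun x : ℝ => |x| ^ (n i - 1)) (σ i).variation := fun i => by
    refine Integrable.mono_measure ?_ VectorMeasure.variation_sub_le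
    rw [Measure.variation_toSignedMeasure, Measure.variation_toSignedMeasure]
    exact (hν i).add_measure (hμ i)
  have huniv : ∀ i, σ i Set.univ = 0 := fun i => by
    simp [hσ]
  have htail : ∀ i, tailFun (ν i) - tailFun (μ i) = fun A => σ i (Set.Ici A) := fun i => by
    funext A
    simp [hσ, tailFun]
  have hv : ∀ i, VanishingMoments (n i) (τ i).variation (signDensity (τ i)) := fun i =>
    vanishingMoments_signedConvPow (hmom i) (huniv i)
  have hint : ∀ i A, ∫ x, truncPow (n i - 1) A x * signDensity (τ i) x ∂(τ i).variation =
      (n i - 1).factorial * funConvPow (tailFun (ν i) - tailFun (μ i)) (n i) A := fun i A => by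
    have h1 := integral_truncPow_signedConvPow (hmom i) le_rfl A
    rw [Nat.sub_add_cancel (by have := hn i; omega)] at h1
    rw [htail, ← h1]
  have hfac : 0 < ∏ i, ((n i - 1).factorial : ℝ) :=
    Finset.prod_pos fun i _ => by exact_mod_cast Nat.factorial_pos _
  have hprod : ∀ A : Fin d → ℝ,
      ∏ i, ∫ x, truncPow (n i - 1) (A i) x * signDensity (τ i) x ∂(τ i).variation =
        (∏ i, ((n i - 1).factorial : ℝ)) *
          ∏ i, funConvPow (tailFun (ν i) - tailFun (μ i)) (n i) (A i) := fun A => by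
    simp_rw [hint, Finset.prod_mul_distrib]
  constructor
  · intro h A
    have hfi : Integrable (fun x : Fin d → ℝ => ∏ i, truncPow (n i - 1) (A i) (x i))
        (Measure.pi fun i => (τ i).variation) :=
      Integrable.fintype_prod fun i => (hv i).integrable_truncPow (A i)
    -- Continuity of this test function is where `n i ≥ 2` enters: for `n i = 1` the factor would be
    -- an indicator.
    have h1 := h (fun x => ∏ i, truncPow (n i - 1) (A i) (x i))
      (continuous_finsetProd _ fun i _ => (continuous_truncPow (k := n i - 1)
        (by have := hn i; omega)).comp (continuous_const.prodMk (continuous_apply i)))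
      (isBoxConvex_prod_truncPow (fun i => by have := hn i; omega) A)
      VectorMeasure.Integrable.zero_vectorMeasure
      (by rw [VectorMeasure.Integrable, variation_signedPi]; exact hfi)
    rw [VectorMeasure.integral_zero_vectorMeasure, integral_signedPi τ hfi] at h1
    simp_rw [← Finset.prod_mul_distrib] at h1
    rw [integral_fintype_prod_eq_prod (μ := fun i => (τ i).variation) (fun i t =>
      truncPow (n i - 1) (A i) t * signDensity (τ i) t), hprod] at h1
    exact nonneg_of_mul_nonneg_right h1 hfac
  · intro h f hf hbox _ hfi
    rw [VectorMeasure.Integrable, variation_signedPi] at hfi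
    rw [VectorMeasure.integral_zero_vectorMeasure, integral_signedPi τ hfi]
    refine integral_boxConvex_nonneg hn hf hbox hfi hv fun A => ?_
    rw [hprod]
    exact mul_nonneg hfac.le (h A)
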